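/- Let $(\Lambda,\Lambda^*,R,R^*)$ be a reduced semisimple root datum (any Lie type): $\Lambda\simeq\mathbb Z^r$, with simple roots $\alpha_1,\dots,\alpha_r$, Weyl group $W$ generated by the simple reflections $s_1,\dots,s_r$, length function $\ell$, Bruhat order $\le$, and longest element $w_0$. Let $H$ be the generic two-parameter Hecke algebra of $W$ with coefficients extended to $\mathbb Z[t_1,t_2]\otimes Q(\mathbb Z[\Lambda])$, where $Q(\mathbb Z[\Lambda])$ is the fraction field of the group algebra $\mathbb Z[\Lambda]$: it is generated by $h_1,\dots,h_r$ with relations $(h_i-t_1)(h_i-t_2)=0$ and the braid relations $h_ih_jh_i\cdots=h_jh_ih_j\cdots$ ($m_{i,j}$ factors on each side, $m_{i,j}$ the order of $s_is_j$, $i\ne j$). For $\lambda\in\Lambda$ put $E(\lambda)=e^{-\lambda}-1$. For a reduced expression $w=s_{i_1}\cdots s_{i_\ell}$ put $$h_w=h_{i_1}\cdots h_{i_\ell},\qquad Y_w=\prod_{j=1}^{\ell}\Bigl(h_{i_j}+\frac{t_1+t_2}{E(\beta_j)}\Bigr),\qquad \beta_j=s_{i_1}\cdots s_{i_{j-1}}(\alpha_{i_j}),$$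 (factors in the order $j=1,\dots,\ell$), so that $Y_e=1$ and $Y_{ws_i}=Y_w\bigl(h_i+\frac{t_1+t_2}{E(w\alpha_i)}\bigr)$ whenever $ws_i>w$. Then $h_w$ and $Y_w$ do not depend on the reduced expression, and $\{h_w\}_{w\in W}$ (the standard basis) and $\{Y_w\}_{w\in W}$ (the Yang–Baxter basis) are bases of $H$ over $\mathbb Z[t_1,t_2]\otimes Q(\mathbb Z[\Lambda])$. Let $p(w,v)$ and $\tilde p(w,v)$ be the transition coefficients between them, given by $$Y_v=\sum_{w\le v}p(w,v)\,h_w,\qquad h_v=\sum_{w\le v}\tilde p(w,v)\,Y_w,$$ with $p(w,v)=\tilde p(w,v)=0$ if $w\not\le v$. Then for all $w,v\in W$, $$\tilde p(w,v)=(-1)^{\ell(v)-\ell(w)}\,p(vw_0,ww_0).$$ -/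

import Mathlib

namespace YangBaxter

noncomputable section

section Coefficients

variable (Λ : Type*) [AddCommGroup Λ]

/-- The field of fractions `Q(ℤ[Λ])` of the group algebra `ℤ[Λ]`. -/
abbrev FracGroupAlgebra : Type _ := FractionRing (AddMonoidAlgebra ℤ Λ)

/-- The coefficient ring `ℤ[t₁, t₂] ⊗ Q(ℤ[Λ])`, written as the polynomial ring in `t₁, t₂`
over the field `Q(ℤ[Λ])`. -/
abbrev CoeffRing : Type _ := MvPolynomial (Fin 2) (FracGroupAlgebra Λ)

variable {Λ}

/-- The parameter `t₁`. -/
abbrev t₁ : CoeffRing Λ := MvPolynomial.X 0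

/-- The parameter `t₂`. -/
abbrev t₂ : CoeffRing Λ := MvPolynomial.X 1

/-- The element `e^lam` of the group algebra. -/
def expo (lam : Λ) : AddMonoidAlgebra ℤ Λ := AddMonoidAlgebra.single lam 1

/-- `E(lam) = e^{-lam} - 1`, as an element of the fraction field. -/
def E (lam : Λ) : FracGroupAlgebra Λ :=
  algebraMap (AddMonoidAlgebra ℤ Λ) (FracGroupAlgebra Λ) (expo (-lam) - 1)

/-- A lattice of finite rank has a group algebra without zero divisors. -/
instance isDomain_groupAlgebra [Module.Free ℤ Λ] [Module.Finite ℤ Λ] :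
    IsDomain (AddMonoidAlgebra ℤ Λ) :=
  haveI : AddMonoid.FG Λ := AddGroup.fg_iff_addMonoid_fg.mp
    (Module.Finite.iff_addGroup_fg.mp inferInstance)
  haveI : IsAddTorsionFree Λ := Module.isTorsionFree_int_iff_isAddTorsionFree.mp inferInstance
  inferInstance

/-- The scalar `(t₁ + t₂) / E(lam)`. -/
def ybCoeff [Module.Free ℤ Λ] [Module.Finite ℤ Λ] (lam : Λ) : CoeffRing Λ :=
  (t₁ + t₂) * MvPolynomial.C (E lam)⁻¹

end Coefficients

section Weyl

variable {ι Λ Λ' : Type*} [AddCommGroup Λ] [AddCommGroup Λ'] {P : RootDatum ι Λ Λ'}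
  (b : P.Base)

/-- The simple reflection `s_i` in the Weyl group. -/
def simpleRefl (i : b.support) : P.weylGroup := RootPairing.weylGroup.ofIdx P i

/-- The element `s_{i₁} ⋯ s_{i_k}` represented by a word in the simple reflections. -/
def wordProd (ω : List b.support) : P.weylGroup := (ω.map (simpleRefl b)).prod

/-- The length `ℓ(w)`: the least length of a word in the simple reflections representing `w`. -/
def length (w : P.weylGroup) : ℕ := sInf {n | ∃ ω : List b.support, wordProd b ω = w ∧ ω.length = n}

/-- A word is reduced if it is a shortest expression of the element it represents. -/
def IsReduced (ω : List b.support) : Prop := ω.length = length b (wordProd b ω)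

/-- The Bruhat order: the reflexive transitive closure of `u < u s_α` for reflections `s_α`
(`α` any root) with `ℓ(u) < ℓ(u s_α)`. -/
def BruhatLE : P.weylGroup → P.weylGroup → Prop :=
  Relation.ReflTransGen fun u v ↦
    ∃ j : ι, v = u * RootPairing.weylGroup.ofIdx P j ∧ length b u < length b v

end Weyl

section Hecke

variable {ι Λ Λ' : Type*} [AddCommGroup Λ] [AddCommGroup Λ'] {P : RootDatum ι Λ Λ'}
  (b : P.Base)

/-- The alternating word `i, j, i, j, …` with `m` letters, starting with `i`. -/
def altWord {α : Type*} (i j : α) : ℕ → List α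
  | 0 => []
  | m + 1 => i :: altWord j i m

/-- The order `m_{i,j}` of `s_i s_j`. -/
def braidOrder (i j : b.support) : ℕ := orderOf (simpleRefl b i * simpleRefl b j)

/-- The quadratic and braid relations on the generators `h_i`. -/
inductive HeckeRel (A : Type*) [CommRing A] (a₁ a₂ : A) :
    FreeAlgebra A b.support → FreeAlgebra A b.support → Prop
  | quadratic (i : b.support) :
      HeckeRel A a₁ a₂
        ((FreeAlgebra.ι A i - algebraMap A _ a₁) * (FreeAlgebra.ι A i - algebraMap A _ a₂)) 0
  | braid (i j : b.support) (hij : i ≠ j) :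
      HeckeRel A a₁ a₂
        (((altWord i j (braidOrder b i j)).map (FreeAlgebra.ι A)).prod)
        (((altWord j i (braidOrder b i j)).map (FreeAlgebra.ι A)).prod)

/-- The two-parameter Hecke algebra of the Weyl group over a commutative ring `A` with
parameters `a₁, a₂`, given by generators and relations. -/
abbrev HeckeAlgebra (A : Type*) [CommRing A] (a₁ a₂ : A) : Type _ := RingQuot (HeckeRel b A a₁ a₂)

/-- The generic Hecke algebra with coefficients extended to `ℤ[t₁, t₂] ⊗ Q(ℤ[Λ])`. -/
abbrev GenericHecke : Type _ := HeckeAlgebra b (CoeffRing Λ) t₁ t₂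

/-- The generator `h_i`. -/
def gen (i : b.support) : GenericHecke b :=
  RingQuot.mkAlgHom (CoeffRing Λ) (HeckeRel b (CoeffRing Λ) t₁ t₂) (FreeAlgebra.ι (CoeffRing Λ) i)

/-- The product `h_{i₁} ⋯ h_{i_k}` of a word. -/
def stdProd (ω : List b.support) : GenericHecke b := (ω.map (gen b)).prod

variable [Module.Free ℤ Λ] [Module.Finite ℤ Λ]

/-- The factor `h_i + (t₁ + t₂) / w E(α_i)`, where `w E(α_i) = E(w α_i)` as `w e^lam = e^{w lam}`. -/
def ybFactor (w : P.weylGroup) (i : b.support) : GenericHecke b :=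
  gen b i + algebraMap (CoeffRing Λ) (GenericHecke b) (ybCoeff (w • P.root i))

/-- The element obtained from the word `i₁, …, i_k` by the Yang–Baxter recursion
`Y_e = 1`, `Y_{w s_i} = Y_w (h_i + (t₁ + t₂) / w E(α_i))`, with an arbitrary element `u` of
the Weyl group in place of `e` in the indices of the factors. -/
def ybProdFrom : P.weylGroup → List b.support → GenericHecke b
  | _, [] => 1
  | u, i :: ω => ybFactor b u i * ybProdFrom (u * simpleRefl b i) ω

/-- The Yang–Baxter product `∏_j (h_{i_j} + (t₁ + t₂) / E(s_{i₁} ⋯ s_{i_{j-1}} α_{i_j}))`. -/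
def ybProd (ω : List b.support) : GenericHecke b := ybProdFrom b 1 ω

end Hecke

end

end YangBaxter

namespace YangBaxter

set_option linter.unusedSectionVars false

noncomputable section

open RootPairing

/-! ### Positive roots, length and exchange in the Weyl group. -/

section WeylCombinatorics

variable {ι Λ Λ' : Type*} [AddCommGroup Λ] [AddCommGroup Λ'] {P : RootDatum ι Λ Λ'}

/-! Put `S = t₁ + t₂`. The duality comes from the bilinear form `B` on the Hecke algebra with
`B(h_u, h_x) = (-1)^ℓ(x)` if `u w₀ = x` and `0` otherwise (`dualForm`). Let `j` be the simple index
opposite to `i`, so that `w₀ α_j = -α_i`. Right multiplication by `h_i` then has adjoint `S - h_j`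
(`dualForm_mul_gen`). Since `1/E(-β) = -1 - 1/E(β)`, the factor `h_i + S/E(β)` has adjoint `-(h_j +
S/E(-β))`. An induction on `w` shows that the `Y_w` pair by the same formula as the `h_w`
(`dualForm_ybElem`). Computing `B(h_v, Y_{w w₀})` by expanding either argument gives the identity
(`ybBasis_repr_stdElem`).

The rest shows that both families are well defined, are bases, and are triangular for the Bruhat
order. Independence of the reduced word is Matsumoto's theorem (`cocycleProd_eq_of_isReduced`),
stated for products whose factors depend on the group element reached so far. For `h_w` it uses the
braid relations. For `Y_w` it uses the Yang–Baxter equations in the four rank-two types, which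
follow from `ybCoeff_mul_ybCoeff`. Linear independence of the `h_w` comes from the regular
representation on the free module over `W`. The `Y_w` then form a basis because they span. -/

lemma root_smul (w : P.weylGroup) (k : ι) : P.root (w • k) = w • P.root k :=
  (P.weylGroup_apply_root w k).symm

lemma ofIdx_smul_index (i k : ι) : weylGroup.ofIdx P i • k = P.reflectionPerm i k := rfl

lemma weyl_ext {u v : P.weylGroup} (h : ∀ x : Λ, u • x = v • x) : u = v :=
  Subtype.ext (Equiv.weightHom_injective P (LinearEquiv.ext h))

lemma ofIdx_smul_weight (i : ι) (x : Λ) : weylGroup.ofIdx P i • x = P.reflection i x := rfl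

lemma ofIdx_mul_self (i : ι) : weylGroup.ofIdx P i * weylGroup.ofIdx P i = 1 :=
  weyl_ext fun x ↦ by simp [mul_smul]

lemma ofIdx_inv (i : ι) : (weylGroup.ofIdx P i)⁻¹ = weylGroup.ofIdx P i :=
  inv_eq_of_mul_eq_one_right (ofIdx_mul_self i)

lemma mul_ofIdx_mul_ofIdx (w : P.weylGroup) (i : ι) :
    w * weylGroup.ofIdx P i * weylGroup.ofIdx P i = w := by
  rw [mul_assoc, ofIdx_mul_self, mul_one]

lemma ofIdx_reflectionPerm (i k : ι) : weylGroup.ofIdx P (weylGroup.ofIdx P i • k) =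
    weylGroup.ofIdx P i * weylGroup.ofIdx P k * weylGroup.ofIdx P i :=
  weyl_ext fun x ↦ by
    rw [ofIdx_smul_index, ofIdx_smul_weight, reflection_reflectionPerm]
    rfl

lemma ofIdx_smul (w : P.weylGroup) (k : ι) :
    weylGroup.ofIdx P (w • k) = w * weylGroup.ofIdx P k * w⁻¹ := by
  obtain ⟨w, hw⟩ := w
  induction hw using weylGroup.induction generalizing k with
  | mem i =>
    have : (⟨Equiv.reflection P i, P.reflection_mem_weylGroup i⟩ : P.weylGroup) =
      weylGroup.ofIdx P i := rfl
    rw [this, ofIdx_reflectionPerm, ofIdx_inv]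
  | one =>
    have : (⟨1, one_mem _⟩ : P.weylGroup) = 1 := rfl
    rw [this]; simp
  | mul x y hx hy ihx ihy =>
    have : (⟨x * y, mul_mem hx hy⟩ : P.weylGroup) = ⟨x, hx⟩ * ⟨y, hy⟩ := rfl
    rw [this, mul_smul, ihx, ihy]
    group

variable (b : P.Base)

/-- The index `weylGroup.ofIdx P k • k` stands for the root `-α_k`; negative roots are written in
this way below. -/
lemma isPos_neg_iff (k : ι) : b.IsPos (weylGroup.ofIdx P k • k) ↔ ¬ b.IsPos k :=
  Base.IsPos.neg_iff_not b k

lemma smul_ofIdx_smul_self (w : P.weylGroup) (k : ι) :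
    w • weylGroup.ofIdx P k • k = weylGroup.ofIdx P (w • k) • w • k := by
  rw [ofIdx_smul]; simp [mul_smul]

lemma isPos_smul_neg_iff (w : P.weylGroup) (k : ι) :
    b.IsPos (w • weylGroup.ofIdx P k • k) ↔ ¬ b.IsPos (w • k) := by
  rw [smul_ofIdx_smul_self, isPos_neg_iff]

lemma isPos_simple (i : b.support) : b.IsPos (i : ι) := Base.isPos_of_mem_support i.2

lemma simpleRefl_mul_self (i : b.support) : simpleRefl b i * simpleRefl b i = 1 :=
  ofIdx_mul_self _

lemma simpleRefl_inv (i : b.support) : (simpleRefl b i)⁻¹ = simpleRefl b i := ofIdx_inv _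

lemma mul_simpleRefl_cancel (w : P.weylGroup) (i : b.support) :
    w * simpleRefl b i * simpleRefl b i = w := mul_ofIdx_mul_ofIdx w _

lemma isPos_mul_simpleRefl_iff (w : P.weylGroup) (i : b.support) :
    b.IsPos ((w * simpleRefl b i) • (i : ι)) ↔ ¬ b.IsPos (w • (i : ι)) := by
  rw [mul_smul]; exact isPos_smul_neg_iff b w i

lemma simpleRefl_mul_cancel (w : P.weylGroup) (i : b.support) :
    simpleRefl b i * (simpleRefl b i * w) = w := by
  rw [← mul_assoc, simpleRefl_mul_self, one_mul]

@[simp] lemma wordProd_nil : wordProd b [] = 1 := rfl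

@[simp] lemma wordProd_cons (i : b.support) (ω : List b.support) :
    wordProd b (i :: ω) = simpleRefl b i * wordProd b ω := by simp [wordProd]

@[simp] lemma wordProd_append (ω ω' : List b.support) :
    wordProd b (ω ++ ω') = wordProd b ω * wordProd b ω' := by simp [wordProd]

lemma wordProd_reverse (ω : List b.support) : wordProd b ω.reverse = (wordProd b ω)⁻¹ := by
  induction ω with
  | nil => simp
  | cons i ω ih => simp [ih, simpleRefl_inv]

lemma length_le_of_word (ω : List b.support) : length b (wordProd b ω) ≤ ω.length :=
  Nat.sInf_le ⟨ω, rfl, rfl⟩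

@[simp] lemma length_one : length b (1 : P.weylGroup) = 0 :=
  Nat.le_zero.mp (length_le_of_word b [])

lemma length_simpleRefl_le (i : b.support) : length b (simpleRefl b i) ≤ 1 := by
  simpa using length_le_of_word b [i]

variable [Finite ι] [P.IsReduced]

/-- All length computations rest on this: `s_i` changes only the `α_i`-coefficient, and in a reduced
system a positive root other than `α_i` has another positive coefficient. -/
lemma isPos_simpleRefl_smul {k : ι} (hk : b.IsPos k) (i : b.support) (h : k ≠ i) :
    b.IsPos (simpleRefl b i • k) :=
  Base.IsPos.reflectionPerm hk i.2 h

lemma eq_of_isPos_of_not_isPos {k : ι} (hk : b.IsPos k) (i : b.support)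
    (h : ¬ b.IsPos (simpleRefl b i • k)) : k = i := by
  by_contra hne
  exact h (isPos_simpleRefl_smul b hk i hne)

/-- Every root arises from simple ones by negation and simple reflections. Negation does not change
the reflection, and a simple reflection conjugates it by a letter. -/
lemma exists_word (w : P.weylGroup) : ∃ ω, wordProd b ω = w := by
  have key (i : ι) : ∃ ω, wordProd b ω = weylGroup.ofIdx P i := by
    induction i using b.induction_reflect with
    | h₀ i ih =>
      obtain ⟨ω, hω⟩ := ih
      refine ⟨ω, hω.trans ?_⟩
      rw [← ofIdx_smul_index, ofIdx_reflectionPerm, ofIdx_mul_self, one_mul]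
    | h₁ i hi => exact ⟨[⟨i, hi⟩], by simp [simpleRefl]⟩
    | h₂ i j ih hj =>
      obtain ⟨ω, hω⟩ := ih
      refine ⟨⟨j, hj⟩ :: (ω ++ [⟨j, hj⟩]), ?_⟩
      rw [← ofIdx_smul_index, ofIdx_reflectionPerm, ← hω]
      simp [simpleRefl, mul_assoc]
  obtain ⟨w, hw⟩ := w
  induction hw using weylGroup.induction with
  | mem i => exact key i
  | one => exact ⟨[], rfl⟩
  | mul x y hx hy ihx ihy =>
    obtain ⟨ω, hω⟩ := ihx
    obtain ⟨ω', hω'⟩ := ihy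
    exact ⟨ω ++ ω', by rw [wordProd_append, hω, hω']; rfl⟩

lemma exists_reduced_word (w : P.weylGroup) : ∃ ω, wordProd b ω = w ∧ ω.length = length b w := by
  have : {n | ∃ ω : List b.support, wordProd b ω = w ∧ ω.length = n}.Nonempty := by
    obtain ⟨ω, h⟩ := exists_word b w
    exact ⟨_, ω, h, rfl⟩
  exact Nat.sInf_mem this

lemma length_inv (w : P.weylGroup) : length b w⁻¹ = length b w := by
  have key (w : P.weylGroup) : length b w⁻¹ ≤ length b w := by
    obtain ⟨ω, rfl, h⟩ := exists_reduced_word b w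
    rw [← h, ← wordProd_reverse, ← List.length_reverse]
    exact length_le_of_word b _
  exact le_antisymm (key w) (by simpa using key w⁻¹)

lemma length_mul_le (u v : P.weylGroup) : length b (u * v) ≤ length b u + length b v := by
  obtain ⟨ω, rfl, h⟩ := exists_reduced_word b u
  obtain ⟨ω', rfl, h'⟩ := exists_reduced_word b v
  rw [← h, ← h', ← wordProd_append, ← List.length_append]
  exact length_le_of_word b _

lemma length_eq_zero_iff {w : P.weylGroup} : length b w = 0 ↔ w = 1 := by
  refine ⟨fun h ↦ ?_, by rintro rfl; simp⟩
  obtain ⟨ω, rfl, h'⟩ := exists_reduced_word b w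
  rw [h, List.length_eq_zero_iff] at h'
  simp [h']

/-- The strong exchange property, in terms of roots. -/
lemma exists_shorter_word (ω : List b.support) {k : ι} (hk : b.IsPos k)
    (h : ¬ b.IsPos (wordProd b ω • k)) :
    ∃ ω', ω'.length < ω.length ∧ wordProd b ω' = wordProd b ω * weylGroup.ofIdx P k := by
  induction ω with
  | nil => simp [hk] at h
  | cons i ω ih =>
    -- If the root is still positive before the letter `i` acts, it equals `α_i` there, and
    -- multiplying by its reflection deletes that letter.
    by_cases hpos : b.IsPos (wordProd b ω • k)
    · refine ⟨ω, by simp, ?_⟩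
      rw [wordProd_cons, mul_smul] at h
      have := eq_of_isPos_of_not_isPos b hpos i h
      rw [wordProd_cons, simpleRefl, ← this, ofIdx_smul]
      simp [mul_assoc, ofIdx_mul_self]
    · obtain ⟨ω', hlt, hω'⟩ := ih hpos
      exact ⟨i :: ω', by simpa using hlt, by simp [hω', mul_assoc]⟩

lemma length_mul_ofIdx_lt {w : P.weylGroup} {k : ι} (hk : b.IsPos k) (h : ¬ b.IsPos (w • k)) :
    length b (w * weylGroup.ofIdx P k) < length b w := by
  obtain ⟨ω, rfl, hl⟩ := exists_reduced_word b w
  obtain ⟨ω', hlt, hω'⟩ := exists_shorter_word b ω hk h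
  rw [← hω', ← hl]
  exact (length_le_of_word b ω').trans_lt hlt

lemma lt_length_mul_ofIdx {w : P.weylGroup} {k : ι} (hk : b.IsPos k) (h : b.IsPos (w • k)) :
    length b w < length b (w * weylGroup.ofIdx P k) := by
  have := length_mul_ofIdx_lt b (w := w * weylGroup.ofIdx P k) hk
    (by rw [mul_smul, isPos_smul_neg_iff]; simpa)
  rwa [mul_ofIdx_mul_ofIdx] at this

lemma lt_length_mul_ofIdx_iff {w : P.weylGroup} {k : ι} (hk : b.IsPos k) :
    length b w < length b (w * weylGroup.ofIdx P k) ↔ b.IsPos (w • k) := by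
  refine ⟨fun h ↦ ?_, lt_length_mul_ofIdx b hk⟩
  by_contra h'
  exact lt_asymm h (length_mul_ofIdx_lt b hk h')

lemma length_mul_simpleRefl_of_isPos {w : P.weylGroup} {i : b.support} (h : b.IsPos (w • (i : ι))) :
    length b (w * simpleRefl b i) = length b w + 1 := by
  have h1 : length b w < length b (w * simpleRefl b i) := lt_length_mul_ofIdx b (isPos_simple b i) h
  have h2 := length_mul_le b w (simpleRefl b i)
  have h3 := length_simpleRefl_le b i
  omega

lemma length_mul_simpleRefl_of_not_isPos {w : P.weylGroup} {i : b.support}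
    (h : ¬ b.IsPos (w • (i : ι))) : length b (w * simpleRefl b i) + 1 = length b w := by
  have := length_mul_simpleRefl_of_isPos b (w := w * simpleRefl b i) (i := i)
    (by rw [mul_smul]; exact (isPos_smul_neg_iff b w i).mpr h)
  rwa [mul_simpleRefl_cancel, eq_comm] at this

lemma length_mul_simpleRefl_eq_add_one_iff {w : P.weylGroup} {i : b.support} :
    length b (w * simpleRefl b i) = length b w + 1 ↔ b.IsPos (w • (i : ι)) := by
  refine ⟨fun h ↦ ?_, length_mul_simpleRefl_of_isPos b⟩
  by_contra h'
  have := length_mul_simpleRefl_of_not_isPos b h'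
  omega

lemma length_simpleRefl_mul (w : P.weylGroup) (i : b.support) :
    length b (simpleRefl b i * w) = length b (w⁻¹ * simpleRefl b i) := by
  rw [← length_inv, mul_inv_rev, simpleRefl_inv]

lemma length_simpleRefl (i : b.support) : length b (simpleRefl b i) = 1 := by
  simpa using length_mul_simpleRefl_of_isPos b (w := 1) (i := i) (by simpa using isPos_simple b i)

lemma exists_descent {w : P.weylGroup} (hw : w ≠ 1) :
    ∃ i : b.support, ¬ b.IsPos (w • (i : ι)) := by
  obtain ⟨ω, rfl, hl⟩ := exists_reduced_word b w
  rcases List.eq_nil_or_concat ω with rfl | ⟨ω', i, rfl⟩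
  · simp at hw
  · refine ⟨i, fun h ↦ ?_⟩
    have := length_mul_simpleRefl_of_isPos b h
    rw [← hl] at this
    have h' := length_le_of_word b ω'
    rw [List.concat_eq_append, wordProd_append, wordProd_cons, wordProd_nil, mul_one,
      mul_simpleRefl_cancel] at this
    simp at this
    omega

/-- The action on the finite set of roots is faithful, because a nontrivial element makes some
simple root negative. -/
lemma finite_weylGroup (b : P.Base) : Finite P.weylGroup := by
  have hinj : Function.Injective (MulAction.toPermHom P.weylGroup ι) := by
    rw [injective_iff_map_eq_one]
    intro w hw
    by_contra hne
    obtain ⟨i, hi⟩ := exists_descent b hne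
    apply hi
    have : w • (i : ι) = i := congrArg (fun f : Equiv.Perm ι ↦ f i) hw
    rw [this]
    exact isPos_simple b i
  exact Finite.of_injective _ hinj

/-- Induction along right multiplication by simple reflections increasing the length. -/
lemma weyl_induction {p : P.weylGroup → Prop} (one : p 1)
    (mul : ∀ w (i : b.support), b.IsPos (w • (i : ι)) → p w → p (w * simpleRefl b i))
    (w : P.weylGroup) : p w := by
  generalize hn : length b w = n
  induction n generalizing w with
  | zero => rw [length_eq_zero_iff] at hn; rwa [hn]
  | succ n ih =>
    obtain ⟨i, hi⟩ := exists_descent b (w := w) (by rintro rfl; simp at hn)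
    have := length_mul_simpleRefl_of_not_isPos b hi
    rw [← mul_simpleRefl_cancel b w i]
    exact mul _ _ ((isPos_mul_simpleRefl_iff b w i).mpr hi) (ih _ (by omega))

lemma ofIdx_eq_simpleRefl {k : ι} {i : b.support} (hk : b.IsPos k)
    (h : weylGroup.ofIdx P k = simpleRefl b i) : k = i := by
  apply eq_of_isPos_of_not_isPos b hk i
  rw [← h, isPos_neg_iff]
  simpa

/-- If `s_i w > w` and `w s_j > w` while not `s_i w s_j > w s_j`, then `s_i w = w s_j`; more
generally the left ascents of `w` and `w s_j` agree unless `s_i w = w s_j`. -/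
lemma isPos_inv_mul_simpleRefl_iff {w : P.weylGroup} {i j : b.support}
    (h : simpleRefl b i * w ≠ w * simpleRefl b j) :
    b.IsPos ((w * simpleRefl b j)⁻¹ • (i : ι)) ↔ b.IsPos (w⁻¹ • (i : ι)) := by
  have key (w : P.weylGroup) (h : simpleRefl b i * w ≠ w * simpleRefl b j)
      (hp : b.IsPos (w⁻¹ • (i : ι))) : b.IsPos ((w * simpleRefl b j)⁻¹ • (i : ι)) := by
    rw [mul_inv_rev, simpleRefl_inv, mul_smul]
    -- Only `w⁻¹ α_i = α_j` could spoil positivity, and conjugating reflections turns this into `s_i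
    -- w = w s_j`.
    refine isPos_simpleRefl_smul b hp j fun heq ↦ h ?_
    have : weylGroup.ofIdx P (w⁻¹ • (i : ι)) = simpleRefl b j := by rw [heq]; rfl
    rw [ofIdx_smul, inv_inv] at this
    rw [← this, simpleRefl]
    group
  refine ⟨fun hp ↦ ?_, key w h⟩
  have := key (w * simpleRefl b j) (fun h' ↦ h ?_) hp
  · rwa [mul_simpleRefl_cancel] at this
  · rw [mul_simpleRefl_cancel, ← mul_assoc] at h'
    rw [← mul_simpleRefl_cancel b (simpleRefl b i * w) j, h']

lemma isPos_simpleRefl_mul_iff {w : P.weylGroup} {i j : b.support}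
    (h : simpleRefl b i * w ≠ w * simpleRefl b j) :
    b.IsPos ((simpleRefl b i * w) • (j : ι)) ↔ b.IsPos (w • (j : ι)) := by
  have := isPos_inv_mul_simpleRefl_iff b (w := w⁻¹) (i := j) (j := i) fun h' ↦ h ?_
  · simpa [simpleRefl_inv] using this
  · have := congrArg (·⁻¹) h'
    simpa [simpleRefl_inv] using this.symm

end WeylCombinatorics

/-! ### The longest element. -/

section LongestElement

variable {ι Λ Λ' : Type*} [AddCommGroup Λ] [AddCommGroup Λ'] {P : RootDatum ι Λ Λ'}
  [Finite ι] [P.IsReduced] (b : P.Base)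

lemma exists_longest : ∃ w₀ : P.weylGroup, ∀ w, length b w ≤ length b w₀ :=
  haveI := finite_weylGroup b
  Finite.exists_max (length b)

variable {b} {w₀ : P.weylGroup} (hw₀ : ∀ w, length b w ≤ length b w₀)
include hw₀

lemma not_isPos_longest_smul {k : ι} (hk : b.IsPos k) : ¬ b.IsPos (w₀ • k) := fun h ↦
  (hw₀ _).not_gt (lt_length_mul_ofIdx b hk h)

lemma isPos_longest_smul_iff (k : ι) : b.IsPos (w₀ • k) ↔ ¬ b.IsPos k := by
  refine ⟨fun h hk ↦ not_isPos_longest_smul hw₀ hk h, fun h ↦ ?_⟩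
  have := not_isPos_longest_smul hw₀ ((isPos_neg_iff b k).mpr h)
  rwa [isPos_smul_neg_iff, not_not] at this

/-- Since `w₀` exchanges positive and negative roots, each ascent of `u` is a descent of `w₀ u`. -/
lemma length_longest_mul (u : P.weylGroup) : length b (w₀ * u) + length b u = length b w₀ := by
  induction u using weyl_induction b with
  | one => simp
  | mul u i hi ih =>
    rw [length_mul_simpleRefl_of_isPos b hi, ← mul_assoc]
    have := length_mul_simpleRefl_of_not_isPos b (w := w₀ * u) (i := i)
      (by rw [mul_smul, isPos_longest_smul_iff hw₀]; simpa)
    omega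

lemma eq_longest_of_length_eq {w : P.weylGroup} (h : length b w = length b w₀) : w = w₀ := by
  have := length_longest_mul hw₀ (w₀⁻¹ * w)
  rw [mul_inv_cancel_left, h] at this
  have h1 : length b (w₀⁻¹ * w) = 0 := by omega
  rw [length_eq_zero_iff, inv_mul_eq_one] at h1
  exact h1.symm

lemma longest_inv : w₀⁻¹ = w₀ := eq_longest_of_length_eq hw₀ (length_inv b w₀)

lemma longest_mul_self : w₀ * w₀ = 1 := by
  nth_rw 1 [← longest_inv hw₀]; simp

lemma length_mul_longest (u : P.weylGroup) : length b (u * w₀) + length b u = length b w₀ := by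
  rw [← length_inv, mul_inv_rev, longest_inv hw₀, ← length_inv b u]
  exact length_longest_mul hw₀ _

/-- The conjugate `w₀ s_i w₀` has length one, so it is some `s_j`; the positive root `-w₀ α_i` has
this reflection and hence is `α_j`. -/
lemma exists_opposite (i : b.support) : ∃ j : b.support,
    w₀ * simpleRefl b j = simpleRefl b i * w₀ ∧ w₀ • P.root j = - P.root i := by
  have h1 : length b (w₀ * simpleRefl b i * w₀) = 1 := by
    have h1 := length_mul_longest hw₀ (w₀ * simpleRefl b i)
    have h2 := length_longest_mul hw₀ (simpleRefl b i)
    rw [length_simpleRefl] at h2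
    omega
  obtain ⟨ω, hω, hl⟩ := exists_reduced_word b (w₀ * simpleRefl b i * w₀)
  rw [h1, List.length_eq_one_iff] at hl
  obtain ⟨j, rfl⟩ := hl
  rw [wordProd_cons, wordProd_nil, mul_one] at hω
  refine ⟨j, by rw [hω, ← mul_assoc, ← mul_assoc, longest_mul_self hw₀, one_mul], ?_⟩
  have h2 : weylGroup.ofIdx P (w₀ • weylGroup.ofIdx P i • (i : ι)) = simpleRefl b j := by
    rw [ofIdx_smul, ofIdx_smul, hω, longest_inv hw₀, ofIdx_inv, ofIdx_mul_self, one_mul]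
    rfl
  have h3 := ofIdx_eq_simpleRefl b (by
    rw [isPos_longest_smul_iff hw₀, isPos_neg_iff]; simpa using isPos_simple b i) h2
  rw [← root_smul, ← h3, ← mul_smul, longest_mul_self hw₀, one_smul, ofIdx_smul_index]
  simp

end LongestElement

/-! ### The Bruhat order and its lifting property. -/

section Bruhat

variable {ι Λ Λ' : Type*} [AddCommGroup Λ] [AddCommGroup Λ'] {P : RootDatum ι Λ Λ'}
  (b : P.Base)

lemma BruhatLE.length_le {u v : P.weylGroup} (h : BruhatLE b u v) : length b u ≤ length b v := by
  induction h with
  | refl => rfl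
  | tail _ h ih => obtain ⟨j, -, hj⟩ := h; omega

lemma BruhatLE.eq_of_length_le {u v : P.weylGroup} (h : BruhatLE b u v)
    (hl : length b v ≤ length b u) : u = v := by
  rcases Relation.ReflTransGen.cases_tail h with h | ⟨x, hx, j, -, hj⟩
  · exact h.symm
  · have := BruhatLE.length_le b hx
    omega

variable [Finite ι] [P.IsReduced]

lemma bruhatLE_mul_simpleRefl {w : P.weylGroup} {i : b.support} (h : b.IsPos (w • (i : ι))) :
    BruhatLE b w (w * simpleRefl b i) :=
  .single ⟨i, rfl, lt_length_mul_ofIdx b (isPos_simple b i) h⟩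

lemma exists_isPos_of_bruhat_step {u v : P.weylGroup}
    (h : ∃ j : ι, v = u * weylGroup.ofIdx P j ∧ length b u < length b v) :
    ∃ k : ι, b.IsPos k ∧ v = u * weylGroup.ofIdx P k ∧ b.IsPos (u • k) := by
  obtain ⟨j, rfl, hj⟩ := h
  have key : ∃ k, b.IsPos k ∧ weylGroup.ofIdx P k = weylGroup.ofIdx P j := by
    by_cases hp : b.IsPos j
    · exact ⟨j, hp, rfl⟩
    · exact ⟨_, (isPos_neg_iff b j).mpr hp, by simp [ofIdx_smul]⟩
  obtain ⟨k, hk, hkj⟩ := key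
  rw [← hkj] at hj ⊢
  exact ⟨k, hk, rfl, (lt_length_mul_ofIdx_iff b hk).mp hj⟩

/-- The lifting property of the Bruhat order. -/
lemma BruhatLE.mul_simpleRefl {u v : P.weylGroup} (h : BruhatLE b u v) {i : b.support}
    (hv : b.IsPos (v • (i : ι))) : BruhatLE b (u * simpleRefl b i) (v * simpleRefl b i) := by
  -- A chain from `u` to `v` is multiplied by `s_i` on the right step by step. The first alternative
  -- records that the chain met a step by `s_i` itself; the ascent of `v` is needed only to merge
  -- the two.
  suffices BruhatLE b (u * simpleRefl b i) v ∨
      BruhatLE b (u * simpleRefl b i) (v * simpleRefl b i) from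
    this.elim (fun h ↦ h.trans (bruhatLE_mul_simpleRefl b hv)) id
  clear hv
  induction h using Relation.ReflTransGen.head_induction_on with
  | refl => exact .inr .refl
  | head hstep hle ih =>
    rename_i u x
    obtain ⟨k, hk, rfl, hpos⟩ := exists_isPos_of_bruhat_step b hstep
    by_cases hki : k = i
    · subst hki
      exact .inl hle
    · have hs := isPos_simpleRefl_smul b hk i hki
      have hle' : BruhatLE b (u * simpleRefl b i)
          (u * weylGroup.ofIdx P k * simpleRefl b i) := by
        refine .single ⟨simpleRefl b i • k, ?_, ?_⟩
        · rw [ofIdx_smul, simpleRefl_inv]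
          simp only [← mul_assoc]
          rw [mul_simpleRefl_cancel]
        · have : u * weylGroup.ofIdx P k * simpleRefl b i =
              u * simpleRefl b i * weylGroup.ofIdx P (simpleRefl b i • k) := by
            rw [ofIdx_smul, simpleRefl_inv]
            simp only [← mul_assoc]
            rw [mul_simpleRefl_cancel]
          rw [this]
          refine lt_length_mul_ofIdx b hs ?_
          rwa [mul_smul, ← mul_smul (simpleRefl b i), simpleRefl_mul_self, one_smul]
      exact ih.imp hle'.trans hle'.trans

end Bruhat

/-! ### Rank-two root subsystems and braid orders. -/

section RankTwo

variable {ι Λ Λ' : Type*} [AddCommGroup Λ] [AddCommGroup Λ'] {P : RootDatum ι Λ Λ'}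
  (b : P.Base)

lemma wordProd_altWord_eq (i j : b.support) (n : ℕ) :
    wordProd b (altWord i j n) =
      (simpleRefl b i * simpleRefl b j) ^ n * wordProd b (altWord j i n) := by
  induction n generalizing i j with
  | zero => simp [altWord]
  | succ n ih =>
    have h : simpleRefl b i * (simpleRefl b j * simpleRefl b i) ^ n =
        (simpleRefl b i * simpleRefl b j) ^ n * simpleRefl b i := by
      rw [← mul_pow_mul]
    rw [altWord, altWord, wordProd_cons, wordProd_cons, ih j i, ← mul_assoc, h, pow_succ]
    simp only [mul_assoc]
    rw [simpleRefl_mul_cancel]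

lemma wordProd_altWord_braidOrder (i j : b.support) :
    wordProd b (altWord i j (braidOrder b i j)) = wordProd b (altWord j i (braidOrder b i j)) := by
  rw [wordProd_altWord_eq, braidOrder, pow_orderOf_eq_one, one_mul]

/-- The indices of the roots `s_{i₁} ⋯ s_{i_{j-1}} α_{i_j}` attached to a word. -/
def inversionIndices : List b.support → List ι
  | [] => []
  | i :: ω => (i : ι) :: (inversionIndices ω).map (simpleRefl b i • ·)

/-- Positivity is the sign of the height, so linearity of the height carries positivity through
combinations of roots. -/
lemma height_of_root_eq_add {k l m : ι} {a c : ℤ}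
    (h : P.root k = a • P.root l + c • P.root m) :
    b.height k = a * b.height l + c * b.height m := by
  obtain ⟨f, -, -, hf⟩ := b.exists_root_eq_sum_int l
  obtain ⟨g, -, -, hg⟩ := b.exists_root_eq_sum_int m
  have hk : P.root k = ∑ j ∈ b.support, (a • f + c • g) j • P.root j := by
    rw [h, hf, hg]
    simp only [Pi.add_apply, Pi.smul_apply, add_smul, Finset.sum_add_distrib, Finset.smul_sum,
      smul_eq_mul, mul_smul]
  rw [Base.height_eq_sum hk, Base.height_eq_sum hf, Base.height_eq_sum hg]
  simp [Finset.sum_add_distrib, Finset.mul_sum]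

lemma smul_zsmul_weight (w : P.weylGroup) (a : ℤ) (x : Λ) : w • (a • x) = a • (w • x) :=
  map_zsmul (DistribSMul.toAddMonoidHom Λ w) a x

lemma not_isPos_smul_of_root_eq_add {w : P.weylGroup} {k l m : ι} {a c : ℤ} (ha : 0 ≤ a)
    (hc : 0 ≤ c) (h : P.root k = a • P.root l + c • P.root m) (hl : ¬ b.IsPos (w • l))
    (hm : ¬ b.IsPos (w • m)) : ¬ b.IsPos (w • k) := by
  have := height_of_root_eq_add b (k := w • k) (l := w • l) (m := w • m) (a := a) (c := c)
    (by rw [root_smul, h, smul_add, smul_zsmul_weight, smul_zsmul_weight, root_smul, root_smul])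
  rw [Base.isPos_iff] at *
  rw [this]
  nlinarith

lemma simpleRefl_smul_root_self (i : b.support) : simpleRefl b i • P.root i = -P.root i := by
  rw [simpleRefl, ofIdx_smul_weight, reflection_apply_self]

/-- The pairings of a pair of simple roots. -/
structure PairData (i j : b.support) (p q : ℤ) : Prop where
  smul_right : simpleRefl b i • P.root j = P.root j + p • P.root i
  smul_left : simpleRefl b j • P.root i = P.root i + q • P.root j

variable {b}

lemma PairData.symm {i j : b.support} {p q : ℤ} (h : PairData b i j p q) : PairData b j i q p :=
  ⟨h.smul_left, h.smul_right⟩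

lemma PairData.step_left {i j : b.support} {p q : ℤ} (h : PairData b i j p q) (a c : ℤ) :
    simpleRefl b i • (a • P.root i + c • P.root j) =
      (p * c - a) • P.root i + c • P.root j := by
  rw [smul_add, smul_zsmul_weight, smul_zsmul_weight, h.smul_right, simpleRefl_smul_root_self]
  module

lemma PairData.step_right {i j : b.support} {p q : ℤ} (h : PairData b i j p q) (a c : ℤ) :
    simpleRefl b j • (a • P.root i + c • P.root j) =
      a • P.root i + (q * a - c) • P.root j := by
  rw [add_comm, h.symm.step_left, add_comm]

lemma simpleRefl_smul_eq (i : b.support) (x : Λ) :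
    simpleRefl b i • x = x - P.toLinearMap x (P.coroot i) • P.root i := by
  rw [simpleRefl, ofIdx_smul_weight, reflection_apply]
  rfl

/-- An element is trivial only if it fixes all of `Λ`, so the plane computation is also carried out
on translates `x + a α_i + c α_j` of an arbitrary weight. -/
lemma PairData.step_left_weight {i j : b.support} {p q : ℤ} (h : PairData b i j p q) (x : Λ)
    (a c : ℤ) :
    simpleRefl b i • (x + a • P.root i + c • P.root j) =
      x + (p * c - a - P.toLinearMap x (P.coroot i)) • P.root i + c • P.root j := by
  rw [add_assoc, smul_add, h.step_left, simpleRefl_smul_eq]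
  module

lemma PairData.step_right_weight {i j : b.support} {p q : ℤ} (h : PairData b i j p q) (x : Λ)
    (a c : ℤ) :
    simpleRefl b j • (x + a • P.root i + c • P.root j) =
      x + a • P.root i + (q * a - c - P.toLinearMap x (P.coroot j)) • P.root j := by
  rw [add_assoc, smul_add, h.step_right, simpleRefl_smul_eq]
  module

lemma eq_of_smul_root_add_eq {i j : b.support} (hij : i ≠ j) {a c : ℤ}
    (h : a • P.root i + c • P.root j = P.root i) : a = 1 ∧ c = 0 := by
  have := LinearIndependent.pair_iff.mp (b.linearIndependent_pair_of_ne hij) (a - 1) c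
    (by rw [sub_smul, one_smul, sub_add_eq_add_sub, h, sub_self])
  exact ⟨by omega, this.2⟩

lemma orderOf_eq_of_forall_lt {G : Type*} [Group G] {g : G} {n : ℕ} (hn : 0 < n) (h : g ^ n = 1)
    (h' : ∀ m, 0 < m → m < n → m ∣ n → g ^ m ≠ 1) : orderOf g = n := by
  have hdvd := orderOf_dvd_of_pow_eq_one h
  by_contra hne
  exact h' _ (Nat.pos_of_dvd_of_pos hdvd hn) (lt_of_le_of_ne (Nat.le_of_dvd hn hdvd) hne) hdvd
    (pow_orderOf_eq_one g)

/-- A power is seen to be nontrivial on `α_i`, written as `1 α_i + 0 α_j` to match the form that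
`step_left` and `step_right` rewrite. -/
lemma simpleRefl_mul_pow_ne_one {i j : b.support} (hij : i ≠ j) {n : ℕ} {a c : ℤ}
    (h : (simpleRefl b i * simpleRefl b j) ^ n • ((1 : ℤ) • P.root i + (0 : ℤ) • P.root j) =
      a • P.root i + c • P.root j) (hac : ¬ (a = 1 ∧ c = 0)) :
    (simpleRefl b i * simpleRefl b j) ^ n ≠ 1 := by
  intro h1
  apply hac
  apply eq_of_smul_root_add_eq hij
  rw [← h, h1]
  simp

lemma simpleRefl_mul_pow_eq_one {i j : b.support} {n : ℕ}
    (h : ∀ x : Λ, (simpleRefl b i * simpleRefl b j) ^ n •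
      (x + (0 : ℤ) • P.root i + (0 : ℤ) • P.root j) = x) :
    (simpleRefl b i * simpleRefl b j) ^ n = 1 := by
  refine weyl_ext fun x ↦ ?_
  simpa using h x

lemma PairData.braidOrder_eq_two {i j : b.support} (hij : i ≠ j) (h : PairData b i j 0 0) :
    braidOrder b i j = 2 := by
  refine orderOf_eq_of_forall_lt (by norm_num) (simpleRefl_mul_pow_eq_one fun x ↦ ?_)
    fun m hm hm' _ ↦ ?_
  · simp only [pow_succ, pow_zero, one_mul, mul_smul, h.step_left_weight, h.step_right_weight]
    module
  · interval_cases m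
    exact simpleRefl_mul_pow_ne_one hij (by
      simp only [pow_succ, pow_zero, one_mul, mul_smul, h.step_left, h.step_right]; rfl)
      (by norm_num)

lemma PairData.braidOrder_eq_three {i j : b.support} (hij : i ≠ j) (h : PairData b i j 1 1) :
    braidOrder b i j = 3 := by
  refine orderOf_eq_of_forall_lt (by norm_num) (simpleRefl_mul_pow_eq_one fun x ↦ ?_)
    fun m hm hm' hd ↦ ?_
  · simp only [pow_succ, pow_zero, one_mul, mul_smul, h.step_left_weight, h.step_right_weight]
    module
  · interval_cases m <;> try omega
    exact simpleRefl_mul_pow_ne_one hij (by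
      simp only [pow_succ, pow_zero, one_mul, mul_smul, h.step_left, h.step_right]; rfl)
      (by norm_num)

lemma PairData.braidOrder_eq_four {i j : b.support} (hij : i ≠ j) (h : PairData b i j 1 2) :
    braidOrder b i j = 4 := by
  refine orderOf_eq_of_forall_lt (by norm_num) (simpleRefl_mul_pow_eq_one fun x ↦ ?_)
    fun m hm hm' hd ↦ ?_
  · simp only [pow_succ, pow_zero, one_mul, mul_smul, h.step_left_weight, h.step_right_weight]
    module
  · interval_cases m <;> try omega
    all_goals
      exact simpleRefl_mul_pow_ne_one hij (by
        simp only [pow_succ, pow_zero, one_mul, mul_smul, h.step_left, h.step_right]; rfl)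
        (by norm_num)

lemma PairData.braidOrder_eq_six {i j : b.support} (hij : i ≠ j) (h : PairData b i j 1 3) :
    braidOrder b i j = 6 := by
  refine orderOf_eq_of_forall_lt (by norm_num) (simpleRefl_mul_pow_eq_one fun x ↦ ?_)
    fun m hm hm' hd ↦ ?_
  · simp only [pow_succ, pow_zero, one_mul, mul_smul, h.step_left_weight, h.step_right_weight]
    module
  · interval_cases m <;> try omega
    all_goals
      exact simpleRefl_mul_pow_ne_one hij (by
        simp only [pow_succ, pow_zero, one_mul, mul_smul, h.step_left, h.step_right]; rfl)
        (by norm_num)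

lemma braidOrder_comm (i j : b.support) : braidOrder b i j = braidOrder b j i := by
  rw [braidOrder, braidOrder, ← orderOf_inv, mul_inv_rev, simpleRefl_inv, simpleRefl_inv]

variable (b) [Finite ι] [P.IsReduced]

/-- The numbers are minus the Cartan integers. Being crystallographic, reduced and nonpositive on
distinct simple roots leaves `A₁ × A₁`, `A₂`, and both orientations of `B₂` and `G₂`. -/
lemma exists_pairData {i j : b.support} (hij : i ≠ j) : ∃ p q : ℤ, PairData b i j p q ∧
    (p, q) ∈ ({(0, 0), (1, 1), (1, 2), (1, 3), (2, 1), (3, 1)} : Set (ℤ × ℤ)) := by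
  have hij' : (i : ι) ≠ j := Subtype.coe_injective.ne hij
  have hset := P.pairingIn_pairingIn_mem_set_of_isCrystal_of_isRed' (j : ι) i
    (P.root.injective.ne hij'.symm) (b.root_ne_neg_of_ne j.2 i.2 hij'.symm)
  have h1 := b.pairingIn_le_zero_of_ne hij' i.2 j.2
  have h2 := b.pairingIn_le_zero_of_ne hij'.symm j.2 i.2
  refine ⟨-P.pairingIn ℤ j i, -P.pairingIn ℤ i j, ⟨?_, ?_⟩, ?_⟩
  · rw [simpleRefl, ofIdx_smul_weight, reflection_apply_root' ℤ]; module
  · rw [simpleRefl, ofIdx_smul_weight, reflection_apply_root' ℤ]; module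
  · generalize P.pairingIn ℤ i j = x at *
    generalize P.pairingIn ℤ j i = y at *
    simp only [Set.mem_insert_iff, Set.mem_singleton_iff, Prod.mk.injEq] at hset ⊢
    omega

/-- Each root is computed in coordinates, type by type. Treating both alternating words lets a swap
of `i` and `j` cover the remaining orientations. -/
lemma PairData.inversionIndices_aux {i j : b.support} (hij : i ≠ j) {p q : ℤ}
    (h : PairData b i j p q) (hpq : (p, q) ∈ ({(0, 0), (1, 1), (1, 2), (1, 3)} : Set (ℤ × ℤ))) :
    (∀ k ∈ inversionIndices b (altWord i j (braidOrder b i j)), ∃ a c : ℤ, 0 ≤ a ∧ 0 ≤ c ∧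
      P.root k = a • P.root i + c • P.root j) ∧
    (∀ k ∈ inversionIndices b (altWord j i (braidOrder b i j)), ∃ a c : ℤ, 0 ≤ a ∧ 0 ≤ c ∧
      P.root k = a • P.root i + c • P.root j) := by
  have hi : P.root i = (1 : ℤ) • P.root i + (0 : ℤ) • P.root j := by simp
  have hj : P.root j = (0 : ℤ) • P.root i + (1 : ℤ) • P.root j := by simp
  have close (w : P.weylGroup) (k : ι) (x y : ℤ) (hk : P.root k = x • P.root i + y • P.root j)
      (a c : ℤ) (h' : w • (x • P.root i + y • P.root j) = a • P.root i + c • P.root j)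
      (ha : 0 ≤ a) (hc : 0 ≤ c) : ∃ a c : ℤ, 0 ≤ a ∧ 0 ≤ c ∧
      P.root (w • k) = a • P.root i + c • P.root j :=
    ⟨a, c, ha, hc, by rw [root_smul, hk, h']⟩
  simp only [Set.mem_insert_iff, Set.mem_singleton_iff, Prod.mk.injEq] at hpq
  rcases hpq with ⟨rfl, rfl⟩ | ⟨rfl, rfl⟩ | ⟨rfl, rfl⟩ | ⟨rfl, rfl⟩
  on_goal 1 => rw [h.braidOrder_eq_two hij]
  on_goal 2 => rw [h.braidOrder_eq_three hij]
  on_goal 3 => rw [h.braidOrder_eq_four hij]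
  on_goal 4 => rw [h.braidOrder_eq_six hij]
  all_goals
    simp only [altWord, inversionIndices, List.map_cons, List.map_nil, List.forall_mem_cons,
      List.not_mem_nil, false_imp_iff, implies_true, and_true, ← mul_smul]
    refine ⟨⟨⟨1, 0, by norm_num, by norm_num, hi⟩, ?_⟩, ⟨0, 1, by norm_num, by norm_num, hj⟩, ?_⟩
    all_goals
      repeat' apply And.intro
      all_goals first
        | exact close _ _ _ _ hi _ _ (by
            simp only [mul_smul, h.step_left, h.step_right]; rfl) (by norm_num) (by norm_num)
        | exact close _ _ _ _ hj _ _ (by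
            simp only [mul_smul, h.step_left, h.step_right]; rfl) (by norm_num) (by norm_num)

lemma root_of_mem_inversionIndices {i j : b.support} (hij : i ≠ j) {k : ι}
    (hk : k ∈ inversionIndices b (altWord i j (braidOrder b i j))) :
    ∃ a c : ℤ, 0 ≤ a ∧ 0 ≤ c ∧ P.root k = a • P.root i + c • P.root j := by
  obtain ⟨p, q, h, hpq⟩ := exists_pairData b hij
  by_cases hpq' : (p, q) ∈ ({(0, 0), (1, 1), (1, 2), (1, 3)} : Set (ℤ × ℤ))
  · exact (h.inversionIndices_aux b hij hpq').1 k hk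
  · rw [braidOrder_comm] at hk
    obtain ⟨a, c, ha, hc, h'⟩ := (h.symm.inversionIndices_aux b hij.symm (by
      simp only [Set.mem_insert_iff, Set.mem_singleton_iff, Prod.mk.injEq] at hpq hpq' ⊢
      omega)).2 k hk
    exact ⟨c, a, hc, ha, by rw [h', add_comm]⟩

/-- Stripping the letters of `ω` from the left of `w` one at a time meets a left descent each time,
by the condition on the inversion roots. -/
lemma length_wordProd_inv_mul {w : P.weylGroup} (ω : List b.support)
    (h : ∀ k ∈ inversionIndices b ω, ¬ b.IsPos (w⁻¹ • k)) :
    length b ((wordProd b ω)⁻¹ * w) + ω.length = length b w := by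
  induction ω generalizing w with
  | nil => simp
  | cons i ω ih =>
    simp only [inversionIndices, List.forall_mem_cons, List.forall_mem_map] at h
    have h1 := length_mul_simpleRefl_of_not_isPos b h.1
    rw [← length_simpleRefl_mul, length_inv] at h1
    have h2 := ih (w := simpleRefl b i * w) fun k hk ↦ by
      rw [mul_inv_rev, simpleRefl_inv, mul_smul]
      exact h.2 k hk
    rw [wordProd_cons, mul_inv_rev, simpleRefl_inv, mul_assoc, List.length_cons]
    omega

/-- An element with left descents `i ≠ j` has a reduced expression starting with the alternating
word in `i, j` of length `m_{i,j}`. -/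
lemma length_altWord_inv_mul {w : P.weylGroup} {i j : b.support} (hij : i ≠ j)
    (hi : ¬ b.IsPos (w⁻¹ • (i : ι))) (hj : ¬ b.IsPos (w⁻¹ • (j : ι))) :
    length b ((wordProd b (altWord i j (braidOrder b i j)))⁻¹ * w) +
      (altWord i j (braidOrder b i j)).length = length b w := by
  refine length_wordProd_inv_mul b _ fun k hk ↦ ?_
  obtain ⟨a, c, ha, hc, hk'⟩ := root_of_mem_inversionIndices b hij hk
  exact not_isPos_smul_of_root_eq_add b ha hc hk' hi hj

end RankTwo

/-! ### Matsumoto's theorem for products along words. -/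

section Matsumoto

variable {ι Λ Λ' : Type*} [AddCommGroup Λ] [AddCommGroup Λ'] {P : RootDatum ι Λ Λ'}
  (b : P.Base)

@[simp] lemma length_altWord {α : Type*} (i j : α) (n : ℕ) : (altWord i j n).length = n := by
  induction n generalizing i j with
  | zero => rfl
  | succ n ih => simp [altWord, ih]

/-- The product along a word of factors depending on the element reached so far. -/
def cocycleProd {H : Type*} [Monoid H] (φ : P.weylGroup → b.support → H) :
    P.weylGroup → List b.support → H
  | _, [] => 1
  | u, i :: ω => φ u i * cocycleProd φ (u * simpleRefl b i) ω

lemma cocycleProd_append {H : Type*} [Monoid H] (φ : P.weylGroup → b.support → H)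
    (u : P.weylGroup) (ω ω' : List b.support) :
    cocycleProd b φ u (ω ++ ω') = cocycleProd b φ u ω * cocycleProd b φ (u * wordProd b ω) ω' := by
  induction ω generalizing u with
  | nil => simp [cocycleProd]
  | cons i ω ih => simp [cocycleProd, ih, mul_assoc]

variable {b} in
lemma IsReduced.tail {i : b.support} {ω : List b.support} (h : IsReduced b (i :: ω)) :
    IsReduced b ω := by
  rw [IsReduced, List.length_cons] at h
  have h1 := length_le_of_word b ω
  obtain ⟨ω', hω', hl⟩ : ∃ ω', wordProd b ω' = wordProd b ω ∧ ω'.length = length b (wordProd b ω) :=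
    Nat.sInf_mem (s := {n | ∃ ω' : List b.support, wordProd b ω' = wordProd b ω ∧ ω'.length = n})
      ⟨_, ω, rfl, rfl⟩
  have h2 := length_le_of_word b (i :: ω')
  rw [wordProd_cons, hω', ← wordProd_cons, ← h, List.length_cons] at h2
  rw [IsReduced]
  omega

variable [Finite ι] [P.IsReduced]

variable {b} in
lemma IsReduced.not_isPos {i : b.support} {ω : List b.support} (h : IsReduced b (i :: ω)) :
    ¬ b.IsPos ((wordProd b (i :: ω))⁻¹ • (i : ι)) := by
  intro hpos
  have h1 := length_mul_simpleRefl_of_isPos b hpos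
  rw [← length_simpleRefl_mul, length_inv, wordProd_cons, simpleRefl_mul_cancel, ← wordProd_cons,
    ← h, ← h.tail, List.length_cons] at h1
  omega

lemma braidOrder_pos (i j : b.support) : 0 < braidOrder b i j :=
  haveI := finite_weylGroup b
  orderOf_pos _

/-- Matsumoto's theorem, for products along words. -/
theorem cocycleProd_eq_of_isReduced {H : Type*} [Monoid H] (φ : P.weylGroup → b.support → H)
    (hφ : ∀ u (i j : b.support), i ≠ j → cocycleProd b φ u (altWord i j (braidOrder b i j)) =
      cocycleProd b φ u (altWord j i (braidOrder b i j)))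
    (u : P.weylGroup) {ω ω' : List b.support} (hω : IsReduced b ω) (hω' : IsReduced b ω')
    (h : wordProd b ω = wordProd b ω') : cocycleProd b φ u ω = cocycleProd b φ u ω' := by
  generalize hn : ω.length = n
  have hn' : ω'.length = n := by rw [hω', ← h, ← hω, hn]
  induction n generalizing u ω ω' with
  | zero => rw [List.length_eq_zero_iff.mp hn, List.length_eq_zero_iff.mp hn']
  | succ n ih =>
    obtain ⟨i, ω, rfl⟩ := List.exists_cons_of_length_eq_add_one hn
    obtain ⟨j, ω', rfl⟩ := List.exists_cons_of_length_eq_add_one hn'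
    -- Two reduced words with a common first letter are compared by induction on their tails.
    have same (u : P.weylGroup) (i : b.support) {ω ω' : List b.support}
        (hω : IsReduced b (i :: ω)) (hω' : IsReduced b (i :: ω'))
        (h : wordProd b (i :: ω) = wordProd b (i :: ω')) (hn : (i :: ω).length = n + 1)
        (hn' : (i :: ω').length = n + 1) :
        cocycleProd b φ u (i :: ω) = cocycleProd b φ u (i :: ω') := by
      rw [cocycleProd, cocycleProd, ih _ hω.tail hω'.tail (by simpa using h) (by simpa using hn)
        (by simpa using hn')]
    by_cases hij : i = j
    · subst hij
      exact same u i hω hω' h hn hn'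
    have hi := hω.not_isPos
    have hj := hω'.not_isPos
    rw [← h] at hj
    have hl := length_altWord_inv_mul b hij hi hj
    set w := wordProd b (i :: ω) with hw
    have hwl : length b w = n + 1 := by rw [← hn]; exact hω.symm
    -- With left descents `i` and `j`, `w` has reduced words consisting of either alternating word
    -- followed by the same `η`. Each given word shares its first letter with one of these, and the
    -- braid hypothesis joins the two.
    obtain ⟨η, hη, hηl⟩ := exists_reduced_word b ((wordProd b (altWord i j (braidOrder b i j)))⁻¹ * w)
    have e1 : wordProd b (altWord i j (braidOrder b i j) ++ η) = w := by
      rw [wordProd_append, hη, mul_inv_cancel_left]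
    have e2 : wordProd b (altWord j i (braidOrder b i j) ++ η) = w := by
      rw [wordProd_append, ← wordProd_altWord_braidOrder, hη, mul_inv_cancel_left]
    have l1 : (altWord i j (braidOrder b i j) ++ η).length = n + 1 := by
      rw [List.length_append, hηl]; omega
    have l2 : (altWord j i (braidOrder b i j) ++ η).length = n + 1 := by
      rw [← l1]; simp
    have r1 : IsReduced b (altWord i j (braidOrder b i j) ++ η) := by rw [IsReduced, e1, l1, hwl]
    have r2 : IsReduced b (altWord j i (braidOrder b i j) ++ η) := by rw [IsReduced, e2, l2, hwl]
    have hbraid : cocycleProd b φ u (altWord i j (braidOrder b i j) ++ η) =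
        cocycleProd b φ u (altWord j i (braidOrder b i j) ++ η) := by
      rw [cocycleProd_append, cocycleProd_append, hφ u i j hij, wordProd_altWord_braidOrder]
    -- A positive braid order exposes the first letter of the alternating words, as `same` requires.
    obtain ⟨m, hm⟩ := Nat.exists_eq_add_one_of_ne_zero (braidOrder_pos b i j).ne'
    rw [hm] at e1 e2 l1 l2 r1 r2 hbraid
    rw [same u i hω r1 e1.symm hn l1, same u j hω' r2 (h.symm.trans e2.symm) hn' l2]
    exact hbraid

/-- Every simple reflection is a left descent of `w₀`, so the alternating word can be stripped from
`w₀`; lengths relative to `w₀` then give its own length. -/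
lemma length_wordProd_altWord {i j : b.support} (hij : i ≠ j) :
    length b (wordProd b (altWord i j (braidOrder b i j))) = braidOrder b i j := by
  obtain ⟨w₀, hw₀⟩ := exists_longest b
  have hneg (i : b.support) : ¬ b.IsPos (w₀⁻¹ • (i : ι)) := by
    rw [longest_inv hw₀]
    exact not_isPos_longest_smul hw₀ (isPos_simple b i)
  have h1 := length_altWord_inv_mul b hij (hneg i) (hneg j)
  have h2 := length_mul_longest hw₀ (wordProd b (altWord i j (braidOrder b i j)))⁻¹
  rw [length_inv] at h2
  rw [length_altWord] at h1
  omega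

end Matsumoto

/-! ### Left and right multiplication operators on the free module over `W`. -/

section RegularRepresentation

variable {ι Λ Λ' : Type*} [AddCommGroup Λ] [AddCommGroup Λ'] {P : RootDatum ι Λ Λ'}
  (b : P.Base) {A : Type*} [CommRing A] (S q : A)

open Classical in
/-- Left multiplication by `h_i` in the standard basis of the Hecke algebra with the quadratic
relation `h_i ^ 2 = S h_i - q`. -/
def leftOp (i : b.support) : Module.End A (P.weylGroup →₀ A) :=
  Finsupp.linearCombination A fun w ↦
    if b.IsPos (w⁻¹ • (i : ι)) then Finsupp.single (simpleRefl b i * w) 1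
    else S • Finsupp.single w 1 - q • Finsupp.single (simpleRefl b i * w) 1

open Classical in
/-- Right multiplication by `h_i` in the standard basis of the Hecke algebra with the quadratic
relation `h_i ^ 2 = S h_i - q`. -/
def rightOp (i : b.support) : Module.End A (P.weylGroup →₀ A) :=
  Finsupp.linearCombination A fun w ↦
    if b.IsPos (w • (i : ι)) then Finsupp.single (w * simpleRefl b i) 1
    else S • Finsupp.single w 1 - q • Finsupp.single (w * simpleRefl b i) 1

variable {b} {i j : b.support} {w : P.weylGroup}

lemma leftOp_single_of_isPos (h : b.IsPos (w⁻¹ • (i : ι))) :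
    leftOp b S q i (Finsupp.single w 1) = Finsupp.single (simpleRefl b i * w) 1 := by
  rw [leftOp, Finsupp.linearCombination_single, one_smul, if_pos h]

lemma leftOp_single_of_not_isPos (h : ¬ b.IsPos (w⁻¹ • (i : ι))) :
    leftOp b S q i (Finsupp.single w 1) =
      S • Finsupp.single w 1 - q • Finsupp.single (simpleRefl b i * w) 1 := by
  rw [leftOp, Finsupp.linearCombination_single, one_smul, if_neg h]

lemma rightOp_single_of_isPos (h : b.IsPos (w • (i : ι))) :
    rightOp b S q i (Finsupp.single w 1) = Finsupp.single (w * simpleRefl b i) 1 := by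
  rw [rightOp, Finsupp.linearCombination_single, one_smul, if_pos h]

lemma rightOp_single_of_not_isPos (h : ¬ b.IsPos (w • (i : ι))) :
    rightOp b S q i (Finsupp.single w 1) =
      S • Finsupp.single w 1 - q • Finsupp.single (w * simpleRefl b i) 1 := by
  rw [rightOp, Finsupp.linearCombination_single, one_smul, if_neg h]

lemma isPos_inv_simpleRefl_mul_iff (w : P.weylGroup) (i : b.support) :
    b.IsPos ((simpleRefl b i * w)⁻¹ • (i : ι)) ↔ ¬ b.IsPos (w⁻¹ • (i : ι)) := by
  rw [mul_inv_rev, simpleRefl_inv, isPos_mul_simpleRefl_iff]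

lemma linearMap_ext_single {M : Type*} [AddCommMonoid M] [Module A M] {f g : (P.weylGroup →₀ A) →ₗ[A] M}
    (h : ∀ w, f (Finsupp.single w 1) = g (Finsupp.single w 1)) : f = g :=
  Finsupp.lhom_ext' fun w ↦ LinearMap.ext_ring (h w)

variable (i) in
lemma leftOp_mul_leftOp :
    leftOp b S q i * leftOp b S q i = S • leftOp b S q i - q • 1 := by
  refine linearMap_ext_single fun w ↦ ?_
  simp only [Module.End.mul_apply, LinearMap.sub_apply, LinearMap.smul_apply, Module.End.one_apply]
  by_cases h : b.IsPos (w⁻¹ • (i : ι))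
  · rw [leftOp_single_of_isPos S q h, leftOp_single_of_not_isPos S q
      (by rwa [isPos_inv_simpleRefl_mul_iff, not_not]), simpleRefl_mul_cancel]
  · rw [leftOp_single_of_not_isPos S q h, map_sub, map_smul, map_smul,
      leftOp_single_of_not_isPos S q h,
      leftOp_single_of_isPos S q ((isPos_inv_simpleRefl_mul_iff w i).mpr h), simpleRefl_mul_cancel]

variable [Finite ι] [P.IsReduced]

variable (i j) in
-- Multiplying by `s_j` on the right does not affect the left descent at `i`, nor the reverse,
-- unless `s_i w = w s_j`; that case is checked separately.
lemma leftOp_mul_rightOp :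
    leftOp b S q i * rightOp b S q j = rightOp b S q j * leftOp b S q i := by
  refine linearMap_ext_single fun w ↦ ?_
  simp only [Module.End.mul_apply]
  by_cases heq : simpleRefl b i * w = w * simpleRefl b j
  · have hiff : b.IsPos (w⁻¹ • (i : ι)) ↔ b.IsPos (w • (j : ι)) := by
      rw [← length_mul_simpleRefl_eq_add_one_iff, ← length_mul_simpleRefl_eq_add_one_iff,
        ← length_simpleRefl_mul, heq, length_inv]
    have heq' : simpleRefl b i * (w * simpleRefl b j) = w := by rw [← heq, simpleRefl_mul_cancel]
    by_cases h : b.IsPos (w • (j : ι))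
    · have h' := hiff.mpr h
      rw [rightOp_single_of_isPos S q h, leftOp_single_of_isPos S q h', ← heq,
        leftOp_single_of_not_isPos S q (by rwa [isPos_inv_simpleRefl_mul_iff, not_not]), heq,
        rightOp_single_of_not_isPos S q (by rwa [isPos_mul_simpleRefl_iff, not_not]), heq',
        mul_simpleRefl_cancel]
    · have h' := mt hiff.mp h
      have e1 := leftOp_single_of_isPos S q ((isPos_inv_simpleRefl_mul_iff w i).mpr h')
      have e2 := rightOp_single_of_isPos S q ((isPos_mul_simpleRefl_iff b w j).mpr h)
      rw [simpleRefl_mul_cancel, heq] at e1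
      rw [mul_simpleRefl_cancel] at e2
      rw [rightOp_single_of_not_isPos S q h, leftOp_single_of_not_isPos S q h', heq]
      simp only [map_sub, map_smul]
      rw [e1, e2, rightOp_single_of_not_isPos S q h, leftOp_single_of_not_isPos S q h', heq]
  · have hi := isPos_inv_mul_simpleRefl_iff b heq
    have hj := isPos_simpleRefl_mul_iff b heq
    by_cases h : b.IsPos (w⁻¹ • (i : ι)) <;> by_cases h' : b.IsPos (w • (j : ι))
    · rw [rightOp_single_of_isPos S q h', leftOp_single_of_isPos S q h,
        leftOp_single_of_isPos S q (hi.mpr h), rightOp_single_of_isPos S q (hj.mpr h'), mul_assoc]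
    · rw [rightOp_single_of_not_isPos S q h', leftOp_single_of_isPos S q h,
        rightOp_single_of_not_isPos S q (mt hj.mp h')]
      simp only [map_sub, map_smul]
      rw [leftOp_single_of_isPos S q (hi.mpr h), leftOp_single_of_isPos S q h, mul_assoc]
    · rw [rightOp_single_of_isPos S q h', leftOp_single_of_not_isPos S q h,
        leftOp_single_of_not_isPos S q (mt hi.mp h)]
      simp only [map_sub, map_smul]
      rw [rightOp_single_of_isPos S q (hj.mpr h'), rightOp_single_of_isPos S q h', mul_assoc]
    · rw [rightOp_single_of_not_isPos S q h', leftOp_single_of_not_isPos S q h]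
      simp only [map_sub, map_smul]
      rw [rightOp_single_of_not_isPos S q h', leftOp_single_of_not_isPos S q h,
        leftOp_single_of_not_isPos S q (mt hi.mp h), rightOp_single_of_not_isPos S q (mt hj.mp h'),
        mul_assoc]
      module

lemma prod_leftOp_single_one {ω : List b.support} (h : IsReduced b ω) :
    (ω.map (leftOp b S q)).prod (Finsupp.single 1 1) = Finsupp.single (wordProd b ω) 1 := by
  induction ω with
  | nil => simp
  | cons i ω ih =>
    have hpos : b.IsPos ((wordProd b ω)⁻¹ • (i : ι)) := by
      have := h.not_isPos
      rwa [wordProd_cons, isPos_inv_simpleRefl_mul_iff, not_not] at this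
    rw [List.map_cons, List.prod_cons, Module.End.mul_apply, ih h.tail,
      leftOp_single_of_isPos S q hpos, wordProd_cons]

lemma prod_leftOp_mul_rightOp (ω : List b.support) (j : b.support) :
    (ω.map (leftOp b S q)).prod * rightOp b S q j =
      rightOp b S q j * (ω.map (leftOp b S q)).prod := by
  induction ω with
  | nil => simp
  | cons i ω ih =>
    rw [List.map_cons, List.prod_cons, mul_assoc, ih, ← mul_assoc, leftOp_mul_rightOp, mul_assoc]

lemma isReduced_altWord (hij : i ≠ j) : IsReduced b (altWord i j (braidOrder b i j)) := by
  rw [IsReduced, length_wordProd_altWord b hij, length_altWord]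

/-- Right operators reach every basis vector from that of `1` and commute with left operators, so it
is enough to check at `1`, where both words are reduced words of one element. -/
lemma prod_leftOp_altWord (hij : i ≠ j) :
    ((altWord i j (braidOrder b i j)).map (leftOp b S q)).prod =
      ((altWord j i (braidOrder b i j)).map (leftOp b S q)).prod := by
  refine linearMap_ext_single fun w ↦ ?_
  induction w using weyl_induction b with
  | one =>
    rw [prod_leftOp_single_one S q (isReduced_altWord hij), wordProd_altWord_braidOrder,
      prod_leftOp_single_one S q (by rw [braidOrder_comm]; exact isReduced_altWord hij.symm)]
  | mul w k hk ih =>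
    rw [← rightOp_single_of_isPos S q hk, ← Module.End.mul_apply, ← Module.End.mul_apply,
      prod_leftOp_mul_rightOp, prod_leftOp_mul_rightOp, Module.End.mul_apply, ih,
      Module.End.mul_apply]

end RegularRepresentation

/-! ### The regular representation and linear independence. -/

section RegularRepresentationHom

lemma sub_algebraMap_mul_sub_algebraMap_eq_zero_iff {A H : Type*} [CommRing A] [Ring H]
    [Algebra A H] (x : H) (a₁ a₂ : A) :
    (x - algebraMap A H a₁) * (x - algebraMap A H a₂) = 0 ↔
      x * x = (a₁ + a₂) • x - (a₁ * a₂) • 1 := by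
  rw [← sub_eq_zero (a := x * x), Algebra.algebraMap_eq_smul_one, Algebra.algebraMap_eq_smul_one,
    sub_mul, mul_sub, mul_sub, mul_smul_comm, smul_mul_assoc, smul_mul_assoc, mul_smul_comm,
    one_mul, mul_one, mul_one, smul_smul]
  refine Eq.congr ?_ rfl
  module

variable {ι Λ Λ' : Type*} [AddCommGroup Λ] [AddCommGroup Λ'] {P : RootDatum ι Λ Λ'}
  [Finite ι] [P.IsReduced] (b : P.Base) {A : Type*} [CommRing A] (a₁ a₂ : A)

/-- The regular representation of the Hecke algebra on the free module with basis `W`. -/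
def regularRep : HeckeAlgebra b A a₁ a₂ →ₐ[A] Module.End A (P.weylGroup →₀ A) :=
  RingQuot.liftAlgHom A
    ⟨FreeAlgebra.lift A (leftOp b (a₁ + a₂) (a₁ * a₂)), by
      rintro _ _ (i | ⟨i, j, hij⟩)
      · rw [map_mul, map_sub, map_sub, AlgHom.commutes, AlgHom.commutes, FreeAlgebra.lift_ι_apply,
          map_zero]
        exact (sub_algebraMap_mul_sub_algebraMap_eq_zero_iff
          (H := Module.End A (P.weylGroup →₀ A)) (leftOp b (a₁ + a₂) (a₁ * a₂) i) a₁ a₂).mpr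
          (leftOp_mul_leftOp (a₁ + a₂) (a₁ * a₂) i)
      · simpa only [map_list_prod, List.map_map, Function.comp_def, FreeAlgebra.lift_ι_apply]
          using prod_leftOp_altWord (a₁ + a₂) (a₁ * a₂) hij⟩

lemma regularRep_mkAlgHom_ι (i : b.support) :
    regularRep b a₁ a₂ (RingQuot.mkAlgHom A (HeckeRel b A a₁ a₂) (FreeAlgebra.ι A i)) =
      leftOp b (a₁ + a₂) (a₁ * a₂) i := by
  rw [regularRep, RingQuot.liftAlgHom_mkAlgHom_apply, FreeAlgebra.lift_ι_apply]

/-- Acting on the basis vector of `1` sends the product for `w` to the basis vector of `w`. -/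
lemma linearIndependent_of_isReduced {r : P.weylGroup → List b.support}
    (hr : ∀ w, IsReduced b (r w)) (hr' : ∀ w, wordProd b (r w) = w) :
    LinearIndependent A fun w ↦ ((r w).map fun i ↦
      RingQuot.mkAlgHom A (HeckeRel b A a₁ a₂) (FreeAlgebra.ι A i)).prod := by
  refine LinearIndependent.of_comp
    ((LinearMap.applyₗ (Finsupp.single (1 : P.weylGroup) (1 : A))).comp
      (regularRep b a₁ a₂).toLinearMap) ?_
  convert Finsupp.linearIndependent_single_one A P.weylGroup using 1
  funext w
  have := prod_leftOp_single_one (a₁ + a₂) (a₁ * a₂) (hr w)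
  rw [hr'] at this
  rw [← this]
  simp only [Function.comp_apply, LinearMap.comp_apply, AlgHom.toLinearMap_apply,
    LinearMap.applyₗ_apply_apply, map_list_prod, List.map_map]
  congr! 3
  exact funext (regularRep_mkAlgHom_ι b a₁ a₂)

end RegularRepresentationHom

/-! ### The standard basis. -/

section StandardBasis

variable {ι Λ Λ' : Type*} [AddCommGroup Λ] [AddCommGroup Λ'] {P : RootDatum ι Λ Λ'}
  (b : P.Base)

lemma gen_mul_gen (i : b.support) : gen b i * gen b i =
    ((t₁ + t₂ : CoeffRing Λ)) • gen b i - (t₁ * t₂ : CoeffRing Λ) • (1 : GenericHecke b) := by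
  have := RingQuot.mkAlgHom_rel (CoeffRing Λ)
    (HeckeRel.quadratic (b := b) (A := CoeffRing Λ) (a₁ := t₁) (a₂ := t₂) i)
  rw [map_mul, map_sub, map_sub, AlgHom.commutes, AlgHom.commutes, map_zero] at this
  exact (sub_algebraMap_mul_sub_algebraMap_eq_zero_iff _ _ _).mp this

lemma stdProd_altWord {i j : b.support} (hij : i ≠ j) :
    stdProd b (altWord i j (braidOrder b i j)) = stdProd b (altWord j i (braidOrder b i j)) := by
  have := RingQuot.mkAlgHom_rel (CoeffRing Λ)
    (HeckeRel.braid (b := b) (A := CoeffRing Λ) (a₁ := t₁) (a₂ := t₂) i j hij)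
  rw [map_list_prod, map_list_prod, List.map_map, List.map_map] at this
  exact this

lemma stdProd_eq_cocycleProd (u : P.weylGroup) (ω : List b.support) :
    stdProd b ω = cocycleProd b (fun _ i ↦ gen b i) u ω := by
  induction ω generalizing u with
  | nil => rfl
  | cons i ω ih => rw [cocycleProd, ← ih]; simp [stdProd]

@[simp] lemma stdProd_nil : stdProd b [] = 1 := rfl

@[simp] lemma stdProd_cons (i : b.support) (ω : List b.support) :
    stdProd b (i :: ω) = gen b i * stdProd b ω := by simp [stdProd]

@[simp] lemma stdProd_append (ω ω' : List b.support) :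
    stdProd b (ω ++ ω') = stdProd b ω * stdProd b ω' := by simp [stdProd]

variable [Finite ι] [P.IsReduced]

variable {b} in
lemma stdProd_eq_of_isReduced {ω ω' : List b.support} (hω : IsReduced b ω) (hω' : IsReduced b ω')
    (h : wordProd b ω = wordProd b ω') : stdProd b ω = stdProd b ω' := by
  rw [stdProd_eq_cocycleProd b 1, stdProd_eq_cocycleProd b 1]
  refine cocycleProd_eq_of_isReduced b _ (fun u i j hij ↦ ?_) 1 hω hω' h
  rw [← stdProd_eq_cocycleProd, ← stdProd_eq_cocycleProd, stdProd_altWord b hij]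

/-- A choice of reduced word. -/
def reducedWord (w : P.weylGroup) : List b.support := (exists_reduced_word b w).choose

@[simp] lemma wordProd_reducedWord (w : P.weylGroup) : wordProd b (reducedWord b w) = w :=
  (exists_reduced_word b w).choose_spec.1

lemma isReduced_reducedWord (w : P.weylGroup) : IsReduced b (reducedWord b w) := by
  rw [IsReduced, wordProd_reducedWord]
  exact (exists_reduced_word b w).choose_spec.2

lemma isReduced_cons {w : P.weylGroup} {i : b.support} {ω : List b.support} (h : IsReduced b ω)
    (hw : wordProd b ω = w) (hi : b.IsPos (w⁻¹ • (i : ι))) : IsReduced b (i :: ω) := by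
  have := length_mul_simpleRefl_of_isPos b hi
  rw [← length_simpleRefl_mul, length_inv, ← hw, ← h] at this
  rw [IsReduced, wordProd_cons, this, List.length_cons]

lemma isReduced_concat {w : P.weylGroup} {i : b.support} {ω : List b.support} (h : IsReduced b ω)
    (hw : wordProd b ω = w) (hi : b.IsPos (w • (i : ι))) : IsReduced b (ω ++ [i]) := by
  have := length_mul_simpleRefl_of_isPos b hi
  rw [← hw, ← h] at this
  rw [IsReduced, wordProd_append, wordProd_cons, wordProd_nil, mul_one, this, List.length_append]
  rfl

/-- The element `h_w`. -/
def stdElem (w : P.weylGroup) : GenericHecke b := stdProd b (reducedWord b w)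

variable {b} in
lemma stdElem_wordProd {ω : List b.support} (h : IsReduced b ω) :
    stdElem b (wordProd b ω) = stdProd b ω :=
  stdProd_eq_of_isReduced (isReduced_reducedWord b _) h (wordProd_reducedWord b _)

lemma stdElem_one : stdElem b (1 : P.weylGroup) = 1 :=
  stdElem_wordProd (ω := []) (by simp [IsReduced])

variable {b}

lemma gen_mul_stdElem {w : P.weylGroup} {i : b.support} (h : b.IsPos (w⁻¹ • (i : ι))) :
    gen b i * stdElem b w = stdElem b (simpleRefl b i * w) := by
  have hr := isReduced_cons b (isReduced_reducedWord b w) (wordProd_reducedWord b w) h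
  have := stdElem_wordProd hr
  rwa [stdProd_cons, wordProd_cons, wordProd_reducedWord, eq_comm] at this

lemma stdElem_mul_gen {w : P.weylGroup} {i : b.support} (h : b.IsPos (w • (i : ι))) :
    stdElem b w * gen b i = stdElem b (w * simpleRefl b i) := by
  have hr := isReduced_concat b (isReduced_reducedWord b w) (wordProd_reducedWord b w) h
  have := stdElem_wordProd hr
  rw [stdProd_append, wordProd_append, wordProd_reducedWord, wordProd_cons, wordProd_nil, mul_one,
    stdProd_cons, stdProd_nil, mul_one] at this
  exact this.symm

lemma gen_mul_stdElem_of_not_isPos {w : P.weylGroup} {i : b.support}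
    (h : ¬ b.IsPos (w⁻¹ • (i : ι))) : gen b i * stdElem b w =
      (t₁ + t₂ : CoeffRing Λ) • stdElem b w -
        (t₁ * t₂ : CoeffRing Λ) • stdElem b (simpleRefl b i * w) := by
  have := gen_mul_stdElem ((isPos_inv_simpleRefl_mul_iff w i).mpr h)
  rw [simpleRefl_mul_cancel] at this
  rw [← this, ← mul_assoc, gen_mul_gen, sub_mul, smul_mul_assoc, smul_mul_assoc, one_mul]

lemma stdElem_mul_gen_of_not_isPos {w : P.weylGroup} {i : b.support}
    (h : ¬ b.IsPos (w • (i : ι))) : stdElem b w * gen b i =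
      (t₁ + t₂ : CoeffRing Λ) • stdElem b w -
        (t₁ * t₂ : CoeffRing Λ) • stdElem b (w * simpleRefl b i) := by
  have := stdElem_mul_gen ((isPos_mul_simpleRefl_iff b w i).mpr h)
  rw [mul_simpleRefl_cancel] at this
  rw [← this, mul_assoc, gen_mul_gen, mul_sub, mul_smul_comm, mul_smul_comm, mul_one]

variable (b)

lemma linearIndependent_stdElem : LinearIndependent (CoeffRing Λ) (stdElem b) :=
  linearIndependent_of_isReduced b t₁ t₂ (isReduced_reducedWord b) (wordProd_reducedWord b)

/-- The span contains `1` and is stable under left multiplication by the generators, hence by the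
whole algebra. -/
lemma top_le_span_stdElem : ⊤ ≤ Submodule.span (CoeffRing Λ) (Set.range (stdElem b)) := by
  set N := Submodule.span (CoeffRing Λ) (Set.range (stdElem b)) with hN
  have hmem (w : P.weylGroup) : stdElem b w ∈ N := Submodule.subset_span ⟨w, rfl⟩
  have hgen (i : b.support) (y : GenericHecke b) (hy : y ∈ N) : gen b i * y ∈ N := by
    induction hy using Submodule.span_induction with
    | mem y hy =>
      obtain ⟨w, rfl⟩ := hy
      by_cases h : b.IsPos (w⁻¹ • (i : ι))
      · rw [gen_mul_stdElem h]
        exact hmem _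
      · rw [gen_mul_stdElem_of_not_isPos h]
        exact N.sub_mem (N.smul_mem _ (hmem _)) (N.smul_mem _ (hmem _))
    | zero => rw [mul_zero]; exact N.zero_mem
    | add y z _ _ hy hz => rw [mul_add]; exact N.add_mem hy hz
    | smul a y _ hy => rw [mul_smul_comm]; exact N.smul_mem _ hy
  have key (x : FreeAlgebra (CoeffRing Λ) b.support) : ∀ y ∈ N,
      RingQuot.mkAlgHom (CoeffRing Λ) (HeckeRel b (CoeffRing Λ) t₁ t₂) x * y ∈ N := by
    induction x using FreeAlgebra.induction with
    | grade0 r =>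
      intro y hy
      rw [AlgHom.commutes, ← Algebra.smul_def]
      exact N.smul_mem _ hy
    | grade1 i => exact hgen i
    | mul x x' ih ih' =>
      intro y hy
      rw [map_mul, mul_assoc]
      exact ih _ (ih' _ hy)
    | add x x' ih ih' =>
      intro y hy
      rw [map_add, add_mul]
      exact N.add_mem (ih _ hy) (ih' _ hy)
  rintro x -
  obtain ⟨x, rfl⟩ := RingQuot.mkAlgHom_surjective (CoeffRing Λ) (HeckeRel b (CoeffRing Λ) t₁ t₂) x
  have := key x (stdElem b 1) (hmem 1)
  rwa [stdElem_one, mul_one] at this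

/-- The standard basis `h_w` of the Hecke algebra. -/
def stdBasis : Module.Basis P.weylGroup (CoeffRing Λ) (GenericHecke b) :=
  .mk (linearIndependent_stdElem b) (top_le_span_stdElem b)

@[simp] lemma stdBasis_apply (w : P.weylGroup) : stdBasis b w = stdElem b w :=
  Module.Basis.mk_apply _ _ _

end StandardBasis

/-! ### Yang–Baxter equations in an algebra with quadratic relations. -/

section YangBaxterEquation

variable {A H : Type*} [CommRing A] [Ring H] [Algebra A H] {S q : A} {x y : H}
  (hx : x * x = S • x - q • 1) (hy : y * y = S • y - q • 1)
include hx hy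

omit hy in
lemma mul_mul_of_quadratic (z : H) : x * (x * z) = S • (x * z) - q • z := by
  rw [← mul_assoc, hx, sub_mul, smul_mul_assoc, smul_mul_assoc, one_mul]

omit hx hy in
/-- The Yang–Baxter equation of type `A₁ × A₁`. -/
lemma yangBaxter_two (hb : x * y = y * x) (c₁ c₂ : A) :
    (x + c₁ • 1) * (y + c₂ • 1) = (y + c₂ • 1) * (x + c₁ • 1) := by
  simp only [add_mul, mul_add, smul_mul_assoc, mul_smul_comm, one_mul, mul_one]
  linear_combination (norm := module) hb

/-- The Yang–Baxter equation of type `A₂`. -/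
lemma yangBaxter_three (hb : x * (y * x) = y * (x * y)) {c₁ c₂ c₃ : A}
    (r : c₁ * c₃ = c₂ * (c₁ + c₃ + S)) :
    (x + c₁ • 1) * ((y + c₂ • 1) * (x + c₃ • 1)) =
      (y + c₃ • 1) * ((x + c₂ • 1) * (y + c₁ • 1)) := by
  simp only [add_mul, mul_add, smul_mul_assoc, mul_smul_comm, one_mul, mul_one, smul_add, hx, hy,
    smul_sub]
  linear_combination (norm := module) hb - r • x + r • y

/-- The Yang–Baxter equation of type `B₂`. -/
lemma yangBaxter_four (hb : x * (y * (x * y)) = y * (x * (y * x))) {c₁ c₂ c₃ c₄ : A}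
    (r₁ : c₁ * c₄ = c₂ * (c₁ + c₄ + S)) (r₂ : c₂ * c₄ = c₃ * (c₂ + c₄ + S)) :
    (x + c₁ • 1) * ((y + c₂ • 1) * ((x + c₃ • 1) * (y + c₄ • 1))) =
      (y + c₄ • 1) * ((x + c₃ • 1) * ((y + c₂ • 1) * (x + c₁ • 1))) := by
  -- Up to sign, this is the coefficient of `x * y` and of `y * x` left over when the two sides are
  -- expanded and compared.
  have hd : c₁ * c₂ + c₂ * c₃ + S * c₂ + c₃ * c₄ + S * c₃ - c₁ * c₄ = 0 := by
    linear_combination -r₁ - r₂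
  simp only [add_mul, mul_add, smul_mul_assoc, mul_smul_comm, one_mul, mul_one, smul_add, hx, hy,
    mul_mul_of_quadratic hx, mul_mul_of_quadratic hy, smul_sub, mul_sub]
  linear_combination (norm := module) hb + hd • (x * y) - hd • (y * x)

/-- The Yang–Baxter equation of type `G₂`. -/
lemma yangBaxter_six
    (hb : x * (y * (x * (y * (x * y)))) = y * (x * (y * (x * (y * x))))) {c₁ c₂ c₃ c₄ c₅ c₆ : A}
    (r₁ : c₁ * c₆ = c₂ * (c₁ + c₆ + S)) (r₂ : c₂ * c₆ = c₄ * (c₂ + c₆ + S))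
    (r₃ : c₄ * c₆ = c₅ * (c₄ + c₆ + S)) (r₄ : c₂ * c₄ = c₃ * (c₂ + c₄ + S))
    (r₅ : c₁ * c₅ = c₃ * (c₁ + c₅ + S)) :
    (x + c₁ • 1) * ((y + c₂ • 1) * ((x + c₃ • 1) *
        ((y + c₄ • 1) * ((x + c₅ • 1) * (y + c₆ • 1))))) =
      (y + c₆ • 1) * ((x + c₅ • 1) * ((y + c₄ • 1) *
        ((x + c₃ • 1) * ((y + c₂ • 1) * (x + c₁ • 1))))) := by
  -- The six factors are grouped into two triples, which keeps the expansion manageable.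
  have three {x y : H} (hx : x * x = S • x - q • 1) (c₁ c₂ c₃ : A) :
      (x + c₁ • 1) * ((y + c₂ • 1) * (x + c₃ • 1)) = x * (y * x) + c₃ • (x * y) + c₁ • (y * x) +
        (c₁ * c₂ + c₂ * c₃ + S * c₂) • x + (c₁ * c₃) • y + (c₁ * c₂ * c₃ - q * c₂) • 1 := by
    simp only [add_mul, mul_add, smul_mul_assoc, mul_smul_comm, one_mul, mul_one, smul_add, hx,
      smul_sub]
    module
  have assoc (a b c d e f : H) :
      a * (b * (c * (d * (e * f)))) = (a * (b * c)) * (d * (e * f)) := by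
    simp only [mul_assoc]
  -- After the braid relation, the two sides differ only in the alternating words of length four,
  -- with coefficient `hd`, and of length two, with coefficient `hd'`.
  have hd : c₁ * c₂ + c₂ * c₃ + S * c₂ + c₃ * c₄ + S * c₃ + c₄ * c₅ + S * c₄ + c₅ * c₆ + S * c₅ -
      c₁ * c₆ = 0 := by
    linear_combination -r₁ - r₂ - r₃ - r₄
  have hd' : c₁*c₂*c₃*c₄ - c₂*c₄*q - c₁*c₃*q + c₁*c₂*c₄*c₅ + c₂*c₃*c₄*c₅ + S*c₂*c₄*c₅ - c₃*c₅*q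
      + S*c₁*c₂*c₄ + S*c₂*c₃*c₄ + S*S*c₂*c₄ - S*c₃*q + c₁*c₂*c₅*c₆ + c₂*c₃*c₅*c₆ + S*c₂*c₅*c₆
      + c₃*c₄*c₅*c₆ + S*c₃*c₅*c₆ - c₄*c₆*q + S*c₁*c₂*c₅ + S*c₂*c₃*c₅ + S*S*c₂*c₅ + S*c₃*c₄*c₅
      + S*S*c₃*c₅ - S*c₄*q - c₁*c₄*c₅*c₆ + c₁*c₅*q - c₁*c₃*c₄*c₆ - S*c₁*c₄*c₆ - c₁*c₂*c₃*c₆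
      - S*c₁*c₃*c₆ + c₂*c₆*q = 0 := by
    linear_combination (-S*c₃ - S*c₄ - c₂*c₃ + c₂*c₄ - 2*c₃*c₄ + c₃*c₅ - c₄*c₅) * r₁ +
      (-S*c₃ - c₂*c₃ + c₂*c₄ - c₃*c₄ + q) * r₂ +
      (-S*c₂ - S*c₃ - c₁*c₂ + c₁*c₃ - 2*c₂*c₃ + c₂*c₄ - c₃*c₄) * r₃ +
      (S*c₂ + S*c₄ + c₁*c₂ - c₁*c₅ + c₂*c₄ + c₄*c₅) * r₄ + q * r₅
  rw [assoc, assoc, three hx, three hy, three hy, three hx]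
  simp only [add_mul, mul_add, smul_mul_assoc, mul_smul_comm, one_mul, mul_one, smul_add, hx, hy,
    mul_mul_of_quadratic hx, mul_mul_of_quadratic hy, smul_sub, mul_sub, mul_assoc]
  linear_combination (norm := module) hb + hd • (x * (y * (x * y))) - hd • (y * (x * (y * x))) +
    hd' • (x * y) - hd' • (y * x)

end YangBaxterEquation

/-! ### The coefficients `(t₁ + t₂) / E(λ)`. -/

section YangBaxterCoefficients

variable {Λ : Type*} [AddCommGroup Λ]

lemma E_add (lam mu : Λ) : E (lam + mu) = E lam * E mu + E lam + E mu := by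
  have : expo (-(lam + mu)) = expo (-lam) * expo (-mu) := by
    rw [expo, expo, expo, AddMonoidAlgebra.single_mul_single, one_mul, neg_add]
  rw [E, E, E, this, ← map_mul, ← map_add, ← map_add]
  congr 1
  ring

lemma E_zero : E (0 : Λ) = 0 := by
  rw [E, neg_zero, expo, ← AddMonoidAlgebra.one_def, sub_self, map_zero]

variable [Module.Free ℤ Λ] [Module.Finite ℤ Λ]

lemma E_ne_zero {lam : Λ} (h : lam ≠ 0) : E lam ≠ 0 := by
  rw [E, Ne, FaithfulSMul.algebraMap_eq_zero_iff, sub_eq_zero, expo, AddMonoidAlgebra.one_def]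
  intro h'
  exact h (neg_eq_zero.mp (AddMonoidAlgebra.of_injective h'))

/-- Clearing denominators turns this into `E_add`, that is, multiplicativity of `1 + E`. It is the
only property of the coefficients that the Yang–Baxter equations need. -/
lemma ybCoeff_mul_ybCoeff {lam mu : Λ} (h : lam ≠ 0) (h' : mu ≠ 0) (h'' : lam + mu ≠ 0) :
    ybCoeff lam * ybCoeff mu = ybCoeff (lam + mu) * (ybCoeff lam + ybCoeff mu + (t₁ + t₂)) := by
  have key : (E lam)⁻¹ * (E mu)⁻¹ = (E (lam + mu))⁻¹ * ((E lam)⁻¹ + (E mu)⁻¹ + 1) := by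
    have h1 := E_ne_zero h
    have h2 := E_ne_zero h'
    have h3 := E_ne_zero h''
    have := E_add lam mu
    field_simp
    rw [this]
    ring
  have := congrArg (MvPolynomial.C (σ := Fin 2)) key
  simp only [map_mul, map_add, map_one] at this
  simp only [ybCoeff]
  linear_combination (t₁ + t₂) ^ 2 * this

lemma ybCoeff_neg {lam : Λ} (h : lam ≠ 0) : ybCoeff (-lam) = -(t₁ + t₂) - ybCoeff lam := by
  have key : (E (-lam))⁻¹ = -1 - (E lam)⁻¹ := by
    have h1 := E_ne_zero h
    have h2 := E_ne_zero (neg_ne_zero.mpr h)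
    have := E_add lam (-lam)
    rw [add_neg_cancel, E_zero] at this
    field_simp
    linear_combination -this
  rw [ybCoeff, ybCoeff, key, map_sub, map_neg, map_one]
  ring

end YangBaxterCoefficients

/-! ### Yang–Baxter products along the two alternating words. -/

section YangBaxterElements

variable {ι Λ Λ' : Type*} [AddCommGroup Λ] [AddCommGroup Λ'] {P : RootDatum ι Λ Λ'}
  (b : P.Base) [Module.Free ℤ Λ] [Module.Finite ℤ Λ]

lemma ybFactor_eq (w : P.weylGroup) (i : b.support) :
    ybFactor b w i = gen b i + ybCoeff (w • P.root i) • 1 := by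
  rw [ybFactor, Algebra.algebraMap_eq_smul_one]

lemma ybProdFrom_eq_cocycleProd (u : P.weylGroup) (ω : List b.support) :
    ybProdFrom b u ω = cocycleProd b (ybFactor b) u ω := by
  induction ω generalizing u with
  | nil => rfl
  | cons i ω ih => rw [ybProdFrom, cocycleProd, ih]

variable {b}

lemma smul_ne_zero_of_weyl (w : P.weylGroup) {x : Λ} (hx : x ≠ 0) : w • x ≠ 0 := by
  rwa [Ne, smul_eq_zero_iff_eq]

/-- Supplies the relations assumed in the Yang–Baxter equations: each says that one root of the
plane is the sum of two others, translated by `u`. -/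
lemma ybCoeff_rel {i j : b.support} (hij : i ≠ j) (u : P.weylGroup) {a c a' c' a'' c'' : ℤ}
    (ha : a'' = a + a') (hc : c'' = c + c') (h : ¬ (a = 0 ∧ c = 0)) (h' : ¬ (a' = 0 ∧ c' = 0))
    (h'' : ¬ (a'' = 0 ∧ c'' = 0)) :
    ybCoeff (u • (a • P.root i + c • P.root j)) * ybCoeff (u • (a' • P.root i + c' • P.root j)) =
      ybCoeff (u • (a'' • P.root i + c'' • P.root j)) *
        (ybCoeff (u • (a • P.root i + c • P.root j)) +
          ybCoeff (u • (a' • P.root i + c' • P.root j)) + (t₁ + t₂)) := by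
  have ne {a c : ℤ} (h : ¬ (a = 0 ∧ c = 0)) : u • (a • P.root i + c • P.root j) ≠ 0 :=
    smul_ne_zero_of_weyl u fun h0 ↦
      h (LinearIndependent.pair_iff.mp (b.linearIndependent_pair_of_ne hij) a c h0)
  have hadd : u • (a'' • P.root i + c'' • P.root j) =
      u • (a • P.root i + c • P.root j) + u • (a' • P.root i + c' • P.root j) := by
    rw [← smul_add, ha, hc]
    congr 1
    module
  have h3 := ne h''
  rw [hadd] at h3 ⊢
  exact ybCoeff_mul_ybCoeff (ne h) (ne h') h3

lemma PairData.cocycleProd_altWord {i j : b.support} (hij : i ≠ j) {p q : ℤ}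
    (h : PairData b i j p q) (hpq : (p, q) ∈ ({(0, 0), (1, 1), (1, 2), (1, 3)} : Set (ℤ × ℤ)))
    (u : P.weylGroup) :
    cocycleProd b (ybFactor b) u (altWord i j (braidOrder b i j)) =
      cocycleProd b (ybFactor b) u (altWord j i (braidOrder b i j)) := by
  -- Simple roots are put in coordinates so that `step_left` and `step_right` can compute every root
  -- that occurs.
  have hi (w : P.weylGroup) : ybCoeff (w • P.root i) =
      ybCoeff (w • ((1 : ℤ) • P.root i + (0 : ℤ) • P.root j)) := by simp
  have hj (w : P.weylGroup) : ybCoeff (w • P.root j) =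
      ybCoeff (w • ((0 : ℤ) • P.root i + (1 : ℤ) • P.root j)) := by simp
  have hb := stdProd_altWord b hij
  have hgi := gen_mul_gen b i
  have hgj := gen_mul_gen b j
  simp only [Set.mem_insert_iff, Set.mem_singleton_iff, Prod.mk.injEq] at hpq
  rcases hpq with ⟨rfl, rfl⟩ | ⟨rfl, rfl⟩ | ⟨rfl, rfl⟩ | ⟨rfl, rfl⟩
  on_goal 1 => rw [h.braidOrder_eq_two hij] at hb ⊢
  on_goal 2 => rw [h.braidOrder_eq_three hij] at hb ⊢
  on_goal 3 => rw [h.braidOrder_eq_four hij] at hb ⊢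
  on_goal 4 => rw [h.braidOrder_eq_six hij] at hb ⊢
  all_goals
    simp only [altWord, stdProd_cons, stdProd_nil, mul_one] at hb
    simp only [altWord, cocycleProd, mul_one, ybFactor_eq, hi, hj]
    simp only [mul_smul, h.step_left, h.step_right, Int.reduceMul, Int.reduceSub]
  · exact yangBaxter_two (A := CoeffRing Λ) (H := GenericHecke b) hb _ _
  · refine yangBaxter_three (A := CoeffRing Λ) (H := GenericHecke b) hgi hgj hb ?_
    exact ybCoeff_rel hij u (by norm_num) (by norm_num) (by norm_num) (by norm_num) (by norm_num)
  · refine yangBaxter_four (A := CoeffRing Λ) (H := GenericHecke b) hgi hgj hb ?_ ?_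
    all_goals
      exact ybCoeff_rel hij u (by norm_num) (by norm_num) (by norm_num) (by norm_num) (by norm_num)
  · refine yangBaxter_six (A := CoeffRing Λ) (H := GenericHecke b) hgi hgj hb ?_ ?_ ?_ ?_ ?_
    all_goals
      exact ybCoeff_rel hij u (by norm_num) (by norm_num) (by norm_num) (by norm_num) (by norm_num)

end YangBaxterElements

/-! ### The Yang–Baxter basis and triangularity. -/

section YangBaxterBasis

variable {ι Λ Λ' : Type*} [AddCommGroup Λ] [AddCommGroup Λ'] {P : RootDatum ι Λ Λ'}
  (b : P.Base) [Module.Free ℤ Λ] [Module.Finite ℤ Λ] [Finite ι] [P.IsReduced]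

lemma cocycleProd_ybFactor_altWord (u : P.weylGroup) {i j : b.support} (hij : i ≠ j) :
    cocycleProd b (ybFactor b) u (altWord i j (braidOrder b i j)) =
      cocycleProd b (ybFactor b) u (altWord j i (braidOrder b i j)) := by
  obtain ⟨p, q, h, hpq⟩ := exists_pairData b hij
  by_cases hpq' : (p, q) ∈ ({(0, 0), (1, 1), (1, 2), (1, 3)} : Set (ℤ × ℤ))
  · exact h.cocycleProd_altWord hij hpq' u
  · rw [braidOrder_comm]
    refine (h.symm.cocycleProd_altWord hij.symm ?_ u).symm
    simp only [Set.mem_insert_iff, Set.mem_singleton_iff, Prod.mk.injEq] at hpq hpq' ⊢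
    omega

variable {b} in
lemma ybProd_eq_of_isReduced {ω ω' : List b.support} (hω : IsReduced b ω) (hω' : IsReduced b ω')
    (h : wordProd b ω = wordProd b ω') : ybProd b ω = ybProd b ω' := by
  rw [ybProd, ybProd, ybProdFrom_eq_cocycleProd, ybProdFrom_eq_cocycleProd]
  exact cocycleProd_eq_of_isReduced b _ (fun u _ _ ↦ cocycleProd_ybFactor_altWord b u) 1 hω hω' h

/-- The element `Y_w`. -/
def ybElem (w : P.weylGroup) : GenericHecke b := ybProd b (reducedWord b w)

variable {b}

lemma ybElem_wordProd {ω : List b.support} (h : IsReduced b ω) :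
    ybElem b (wordProd b ω) = ybProd b ω :=
  ybProd_eq_of_isReduced (isReduced_reducedWord b _) h (wordProd_reducedWord b _)

variable (b) in
lemma ybElem_one : ybElem b (1 : P.weylGroup) = 1 :=
  ybElem_wordProd (ω := []) (by simp [IsReduced])

variable {w : P.weylGroup} {i : b.support}

lemma ybElem_mul_simpleRefl (h : b.IsPos (w • (i : ι))) : ybElem b (w * simpleRefl b i) =
    ybElem b w * (gen b i + ybCoeff (w • P.root i) • (1 : GenericHecke b)) := by
  have hr := isReduced_concat b (isReduced_reducedWord b w) (wordProd_reducedWord b w) h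
  have := ybElem_wordProd hr
  rw [wordProd_append, wordProd_reducedWord, wordProd_cons, wordProd_nil, mul_one, ybProd,
    ybProdFrom_eq_cocycleProd, cocycleProd_append, ← ybProdFrom_eq_cocycleProd, ← ybProd,
    wordProd_reducedWord, cocycleProd, cocycleProd, one_mul, mul_one, ybFactor_eq] at this
  exact this

lemma ybElem_mul_gen (h : b.IsPos (w • (i : ι))) : ybElem b w * gen b i =
    ybElem b (w * simpleRefl b i) - ybCoeff (w • P.root i) • ybElem b w := by
  rw [ybElem_mul_simpleRefl h, mul_add, mul_smul_comm, mul_one, add_sub_cancel_right]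

lemma mul_of_quadratic {A H : Type*} [CommRing A] [Ring H] [Algebra A H] {S q : A} {x : H}
    (hx : x * x = S • x - q • 1) (y : H) (c : A) :
    y * (x + (-S - c) • (1 : H)) * x =
      (-c) • (y * (x + (-S - c) • (1 : H))) + (-(q + S * c + c * c)) • y := by
  simp only [mul_add, add_mul, mul_assoc, hx, mul_smul_comm, smul_mul_assoc, mul_one, mul_sub,
    smul_add]
  module

lemma exists_ybElem_mul_gen_of_not_isPos (h : ¬ b.IsPos (w • (i : ι))) : ∃ κ : CoeffRing Λ,
    ybElem b w * gen b i =
      (-ybCoeff (w • P.root i)) • ybElem b w + κ • ybElem b (w * simpleRefl b i) := by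
  have h1 := ybElem_mul_simpleRefl ((isPos_mul_simpleRefl_iff b w i).mpr h)
  have hne : w • P.root i ≠ 0 := by rw [← root_smul]; exact P.ne_zero _
  rw [mul_simpleRefl_cancel, mul_smul, simpleRefl_smul_root_self, smul_neg, ybCoeff_neg hne] at h1
  have h2 := mul_of_quadratic (A := CoeffRing Λ) (H := GenericHecke b) (gen_mul_gen b i)
    (ybElem b (w * simpleRefl b i)) (ybCoeff (w • P.root i))
  rw [← h1] at h2
  exact ⟨_, h2⟩

/-- Both bases satisfy this hypothesis, so one lemma serves both triangularity arguments. -/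
lemma mem_span_image_mul_gen {e : P.weylGroup → GenericHecke b}
    (he : ∀ w, ∃ a c : CoeffRing Λ, e w * gen b i = a • e w + c • e (w * simpleRefl b i))
    {T T' : Set P.weylGroup} (hT : ∀ w ∈ T, w ∈ T' ∧ w * simpleRefl b i ∈ T')
    {x : GenericHecke b} (hx : x ∈ Submodule.span (CoeffRing Λ) (e '' T)) :
    x * gen b i ∈ Submodule.span (CoeffRing Λ) (e '' T') := by
  induction hx using Submodule.span_induction with
  | mem x hx =>
    obtain ⟨w, hw, rfl⟩ := hx
    obtain ⟨a, c, h⟩ := he w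
    rw [h]
    exact Submodule.add_mem _
      (Submodule.smul_mem _ _ (Submodule.subset_span ⟨_, (hT w hw).1, rfl⟩))
      (Submodule.smul_mem _ _ (Submodule.subset_span ⟨_, (hT w hw).2, rfl⟩))
  | zero => rw [zero_mul]; exact Submodule.zero_mem _
  | add x y _ _ hx hy => rw [add_mul]; exact Submodule.add_mem _ hx hy
  | smul a x _ hx => rw [smul_mul_assoc]; exact Submodule.smul_mem _ _ hx

lemma smul_sub_smul_eq_add {A M : Type*} [CommRing A] [AddCommGroup M] [Module A M] (a c : A)
    (x y : M) : a • x - c • y = a • x + (-c) • y := by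
  module

lemma sub_smul_eq_add {A M : Type*} [CommRing A] [AddCommGroup M] [Module A M] (c : A)
    (x y : M) : y - c • x = (-c) • x + (1 : A) • y := by
  module

variable (i) in
lemma exists_stdElem_mul_gen (w : P.weylGroup) : ∃ a c : CoeffRing Λ,
    stdElem b w * gen b i = a • stdElem b w + c • stdElem b (w * simpleRefl b i) := by
  by_cases h : b.IsPos (w • (i : ι))
  · exact ⟨0, 1, by rw [stdElem_mul_gen h, zero_smul, one_smul, zero_add]⟩
  · exact ⟨_, _, (stdElem_mul_gen_of_not_isPos h).trans
      (smul_sub_smul_eq_add (A := CoeffRing Λ) (M := GenericHecke b) _ _ _ _)⟩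

variable (i) in
-- By `ybCoeff_neg` the diagonal coefficient has the same form at ascents and descents. The value of
-- `κ` is left open: wherever this form is used in the duality, it multiplies a zero pairing.
lemma exists_ybElem_mul_gen (w : P.weylGroup) : ∃ κ : CoeffRing Λ, ybElem b w * gen b i =
    (-ybCoeff (w • P.root i)) • ybElem b w + κ • ybElem b (w * simpleRefl b i) := by
  by_cases h : b.IsPos (w • (i : ι))
  · exact ⟨1, (ybElem_mul_gen h).trans
      (sub_smul_eq_add (A := CoeffRing Λ) (M := GenericHecke b) _ _ _)⟩
  · exact exists_ybElem_mul_gen_of_not_isPos h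

lemma bruhat_subset_mul_simpleRefl (h : b.IsPos (w • (i : ι))) :
    ∀ u ∈ {u | BruhatLE b u w}, u ∈ {u | BruhatLE b u (w * simpleRefl b i)} ∧
      u * simpleRefl b i ∈ {u | BruhatLE b u (w * simpleRefl b i)} := fun _ hu ↦
  ⟨hu.trans (bruhatLE_mul_simpleRefl b h), BruhatLE.mul_simpleRefl b hu h⟩

variable (b) in
lemma stdElem_mem_span_ybElem (v : P.weylGroup) :
    stdElem b v ∈ Submodule.span (CoeffRing Λ) (ybElem b '' {w | BruhatLE b w v}) := by
  induction v using weyl_induction b with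
  | one =>
    rw [stdElem_one, ← ybElem_one]
    exact Submodule.subset_span ⟨1, .refl, rfl⟩
  | mul w i h ih =>
    rw [← stdElem_mul_gen h]
    exact mem_span_image_mul_gen (fun w ↦ ⟨_, exists_ybElem_mul_gen i w⟩)
      (bruhat_subset_mul_simpleRefl h) ih

variable (b) in
-- Keeping the lower terms strict gives leading coefficient one. Strictness survives a step since `u
-- ≠ w` implies `u s_i ≠ w s_i`, while anything below `w` is too short to equal `w s_i`.
lemma ybElem_sub_stdElem_mem_span (v : P.weylGroup) : ybElem b v - stdElem b v ∈
    Submodule.span (CoeffRing Λ) (stdElem b '' {w | BruhatLE b w v ∧ w ≠ v}) := by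
  induction v using weyl_induction b with
  | one =>
    rw [stdElem_one, ← ybElem_one, sub_self]
    exact Submodule.zero_mem _
  | mul w i h ih =>
    have hlt {u : P.weylGroup} (hu : BruhatLE b u w) : u ≠ w * simpleRefl b i := by
      rintro rfl
      have h1 := BruhatLE.length_le b hu
      have h2 := length_mul_simpleRefl_of_isPos b h
      omega
    have h1 := mem_span_image_mul_gen (exists_stdElem_mul_gen i)
      (T' := {u | BruhatLE b u (w * simpleRefl b i) ∧ u ≠ w * simpleRefl b i})
      (fun u hu ↦ ⟨⟨(bruhat_subset_mul_simpleRefl h u hu.1).1, hlt hu.1⟩,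
        (bruhat_subset_mul_simpleRefl h u hu.1).2, fun h' ↦ hu.2 (mul_right_cancel h')⟩) ih
    have h2 : Submodule.span (CoeffRing Λ) (stdElem b '' {u | BruhatLE b u w ∧ u ≠ w}) ≤
        Submodule.span (CoeffRing Λ) (stdElem b ''
          {u | BruhatLE b u (w * simpleRefl b i) ∧ u ≠ w * simpleRefl b i}) :=
      Submodule.span_mono (Set.image_mono fun u hu ↦
        ⟨(bruhat_subset_mul_simpleRefl h u hu.1).1, hlt hu.1⟩)
    have h3 : stdElem b w ∈ Submodule.span (CoeffRing Λ) (stdElem b ''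
        {u | BruhatLE b u (w * simpleRefl b i) ∧ u ≠ w * simpleRefl b i}) :=
      Submodule.subset_span ⟨w, ⟨bruhatLE_mul_simpleRefl b h, hlt .refl⟩, rfl⟩
    have h4 : ybElem b (w * simpleRefl b i) - stdElem b (w * simpleRefl b i) =
        (ybElem b w - stdElem b w) * gen b i +
          (ybCoeff (w • P.root i) • (ybElem b w - stdElem b w) +
            ybCoeff (w • P.root i) • stdElem b w) := by
      rw [ybElem_mul_simpleRefl h, ← stdElem_mul_gen h, ← smul_add, sub_add_cancel, sub_mul,
        mul_add, mul_smul_comm, mul_one]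
      abel
    rw [h4]
    exact Submodule.add_mem _ h1
      (Submodule.add_mem _ (Submodule.smul_mem _ _ (h2 ih)) (Submodule.smul_mem _ _ h3))

lemma stdBasis_repr_eq_zero_of_mem_span {T : Set P.weylGroup} {x : GenericHecke b}
    (hx : x ∈ Submodule.span (CoeffRing Λ) (stdElem b '' T)) (hw : w ∉ T) :
    (stdBasis b).repr x w = 0 := by
  have he : stdElem b = stdBasis b := funext fun w ↦ (stdBasis_apply b w).symm
  rw [he, Module.Basis.mem_span_image] at hx
  by_contra hne
  exact hw (hx (Finsupp.mem_support_iff.mpr hne))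

lemma stdBasis_repr_stdElem (w : P.weylGroup) :
    (stdBasis b).repr (stdElem b w) = Finsupp.single w 1 := by
  rw [← stdBasis_apply, Module.Basis.repr_self]

lemma stdBasis_repr_ybElem_self (v : P.weylGroup) : (stdBasis b).repr (ybElem b v) v = 1 := by
  have h := stdBasis_repr_eq_zero_of_mem_span (ybElem_sub_stdElem_mem_span b v) (w := v) (by simp)
  rw [map_sub, Finsupp.sub_apply, sub_eq_zero] at h
  rw [h, stdBasis_repr_stdElem, Finsupp.single_eq_same]

lemma bruhatLE_of_stdBasis_repr_ne_zero {w v : P.weylGroup}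
    (h : (stdBasis b).repr (ybElem b v) w ≠ 0) : BruhatLE b w v := by
  by_contra hle
  have h' := stdBasis_repr_eq_zero_of_mem_span (ybElem_sub_stdElem_mem_span b v) (w := w)
    (fun h' ↦ hle h'.1)
  have hne : w ≠ v := by rintro rfl; exact hle .refl
  rw [map_sub, Finsupp.sub_apply, stdBasis_repr_stdElem, Finsupp.single_eq_of_ne hne,
    sub_zero] at h'
  exact h h'

variable (b)

/-- The map `h_w ↦ Y_w` is onto because each `h_w` lies in the span of the `Y_u`, and a surjective
endomorphism of a finite module over a commutative ring is injective. -/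
lemma bijective_constr_ybElem :
    Function.Bijective ((stdBasis b).constr (CoeffRing Λ) (ybElem b)) := by
  have := finite_weylGroup b
  have : Module.Finite (CoeffRing Λ) (GenericHecke b) := .of_basis (stdBasis b)
  have hsurj : Function.Surjective ((stdBasis b).constr (CoeffRing Λ) (ybElem b)) := by
    rw [← LinearMap.range_eq_top, eq_top_iff, Module.Basis.constr_range]
    refine (top_le_span_stdElem b).trans (Submodule.span_le.mpr ?_)
    rintro _ ⟨w, rfl⟩
    exact Submodule.span_mono (Set.image_subset_range _ _) (stdElem_mem_span_ybElem b w)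
  exact ⟨OrzechProperty.injective_of_surjective_endomorphism _ hsurj, hsurj⟩

/-- The Yang–Baxter basis `Y_w` of the Hecke algebra. -/
def ybBasis : Module.Basis P.weylGroup (CoeffRing Λ) (GenericHecke b) :=
  (stdBasis b).map (.ofBijective _ (bijective_constr_ybElem b))

@[simp] lemma ybBasis_apply (w : P.weylGroup) : ybBasis b w = ybElem b w := by
  rw [ybBasis, Module.Basis.map_apply, LinearEquiv.ofBijective_apply, Module.Basis.constr_basis]

variable {b}

lemma bruhatLE_of_ybBasis_repr_ne_zero {w v : P.weylGroup}
    (h : (ybBasis b).repr (stdElem b v) w ≠ 0) : BruhatLE b w v := by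
  have hx := stdElem_mem_span_ybElem b v
  have he : ybElem b = ybBasis b := funext fun w ↦ (ybBasis_apply b w).symm
  rw [he, Module.Basis.mem_span_image] at hx
  exact hx (Finsupp.mem_support_iff.mpr h)

end YangBaxterBasis

/-! ### The bilinear form and the duality. -/

section Duality

lemma neg_one_pow_mul_neg_one_pow_mul {A : Type*} [CommRing A] (n : ℕ) (x : A) :
    (-1) ^ n * ((-1) ^ n * x) = x := by
  rw [← mul_assoc, ← mul_pow, neg_one_mul, neg_neg, one_pow, one_mul]

lemma bilin_apply_eq_of_basis {A H κ : Type*} [CommRing A] [AddCommGroup H] [Module A H]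
    (β : Module.Basis κ A H) (B : H →ₗ[A] H →ₗ[A] A) (f g : H →ₗ[A] H) (S : A)
    (h : ∀ u x, B (f (β u)) (β x) = S * B (β u) (β x) - B (β u) (g (β x))) (x y : H) :
    B (f x) y = S * B x y - B x (g y) := by
  have : B.comp f = S • B - B.compl₂ g := LinearMap.ext_basis β β h
  exact LinearMap.congr_fun₂ this x y

variable {ι Λ Λ' : Type*} [AddCommGroup Λ] [AddCommGroup Λ'] {P : RootDatum ι Λ Λ'}
  (b : P.Base) [Module.Free ℤ Λ] [Module.Finite ℤ Λ] [Finite ι] [P.IsReduced]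
  (w₀ : P.weylGroup)

open Classical in
/-- The bilinear form for which the standard basis is dual to itself, up to multiplication by `w₀`
and signs. -/
def dualForm : GenericHecke b →ₗ[CoeffRing Λ] GenericHecke b →ₗ[CoeffRing Λ] CoeffRing Λ :=
  (stdBasis b).constr (CoeffRing Λ) fun u ↦ (stdBasis b).constr (CoeffRing Λ) fun x ↦
    if u * w₀ = x then (-1) ^ length b x else 0

open Classical in
lemma dualForm_stdElem (u x : P.weylGroup) : dualForm b w₀ (stdElem b u) (stdElem b x) =
    if u * w₀ = x then (-1) ^ length b x else 0 := by
  rw [dualForm, ← stdBasis_apply, ← stdBasis_apply, Module.Basis.constr_basis,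
    Module.Basis.constr_basis]

lemma dualForm_stdElem_left (u : P.weylGroup) (y : GenericHecke b) :
    dualForm b w₀ (stdElem b u) y =
      (-1) ^ length b (u * w₀) * (stdBasis b).repr y (u * w₀) := by
  classical
  suffices dualForm b w₀ (stdElem b u) =
      ((-1) ^ length b (u * w₀) : CoeffRing Λ) • (stdBasis b).coord (u * w₀) by
    rw [this]; rfl
  refine (stdBasis b).ext fun x ↦ ?_
  rw [stdBasis_apply, dualForm_stdElem, LinearMap.smul_apply, Module.Basis.coord_apply,
    stdBasis_repr_stdElem, Finsupp.single_apply, smul_eq_mul]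
  by_cases h : u * w₀ = x
  · rw [if_pos h, if_pos h.symm, h, mul_one]
  · rw [if_neg h, if_neg (Ne.symm h), mul_zero]

variable {b w₀} (hw₀ : ∀ w, length b w ≤ length b w₀)
include hw₀

lemma isPos_mul_longest_iff {i j : b.support} (hj : w₀ • P.root j = -P.root i)
    (u : P.weylGroup) : b.IsPos ((u * w₀) • (j : ι)) ↔ ¬ b.IsPos (u • (i : ι)) := by
  have : w₀ • (j : ι) = weylGroup.ofIdx P i • (i : ι) := by
    apply P.root.injective
    rw [root_smul, hj, ofIdx_smul_index]
    simp
  rw [mul_smul, this, isPos_smul_neg_iff]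

/-- An `S` term appears exactly at descents, and `u` descends at `i` iff `u w₀` ascends at `j`. So
when `u w₀ = x` exactly one side produces it; the other terms match because `ℓ(x s_j)` and `ℓ(x)`
have opposite parity. -/
lemma dualForm_mul_gen {i j : b.support} (hij : w₀ * simpleRefl b j = simpleRefl b i * w₀)
    (hj : w₀ • P.root j = -P.root i) (x y : GenericHecke b) :
    dualForm b w₀ (x * gen b i) y =
      (t₁ + t₂) * dualForm b w₀ x y - dualForm b w₀ x (y * gen b j) := by
  classical
  refine bilin_apply_eq_of_basis (stdBasis b) (dualForm b w₀)
    (LinearMap.mulRight (CoeffRing Λ) (gen b i)) (LinearMap.mulRight (CoeffRing Λ) (gen b j))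
    (t₁ + t₂) (fun u x ↦ ?_) x y
  have hsign {x : P.weylGroup} {j : b.support} :
      ((-1) ^ length b (x * simpleRefl b j) : CoeffRing Λ) = -(-1) ^ length b x := by
    by_cases h : b.IsPos (x • (j : ι))
    · rw [length_mul_simpleRefl_of_isPos b h, pow_succ]; ring
    · rw [← length_mul_simpleRefl_of_not_isPos b h, pow_succ]; ring
  have hu : u * simpleRefl b i * w₀ = u * w₀ * simpleRefl b j := by
    rw [mul_assoc, ← hij, mul_assoc]
  have heq : u * simpleRefl b i * w₀ = x ↔ u * w₀ = x * simpleRefl b j := by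
    rw [hu]
    constructor
    · rintro rfl; rw [mul_simpleRefl_cancel]
    · intro h; rw [h, mul_simpleRefl_cancel]
  have hpos := isPos_mul_longest_iff hw₀ hj u
  have hxpos := isPos_mul_simpleRefl_iff b x j
  rw [stdBasis_apply, stdBasis_apply]
  change dualForm b w₀ (stdElem b u * gen b i) (stdElem b x) = (t₁ + t₂) *
    dualForm b w₀ (stdElem b u) (stdElem b x) - dualForm b w₀ (stdElem b u) (stdElem b x * gen b j)
  by_cases h : b.IsPos (u • (i : ι)) <;> by_cases h' : b.IsPos (x • (j : ι))
  · rw [stdElem_mul_gen h, stdElem_mul_gen h', dualForm_stdElem, dualForm_stdElem,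
      dualForm_stdElem, hsign]
    have hne : u * w₀ ≠ x := by rintro rfl; exact (hpos.mp h') h
    simp only [heq, if_neg hne]
    split_ifs <;> ring
  · rw [stdElem_mul_gen h, stdElem_mul_gen_of_not_isPos h']
    simp only [map_sub, map_smul, smul_eq_mul, dualForm_stdElem, heq]
    have hne : u * w₀ ≠ x * simpleRefl b j := fun e ↦
      hpos.mp (by rw [e]; exact hxpos.mpr h') h
    simp only [if_neg hne]
    ring
  · rw [stdElem_mul_gen_of_not_isPos h, stdElem_mul_gen h']
    simp only [map_sub, map_smul, LinearMap.sub_apply, LinearMap.smul_apply, smul_eq_mul,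
      dualForm_stdElem, heq]
    have hne : u * w₀ ≠ x * simpleRefl b j := fun e ↦ hxpos.mp (by rw [← e]; exact hpos.mpr h) h'
    simp only [if_neg hne]
    ring
  · rw [stdElem_mul_gen_of_not_isPos h, stdElem_mul_gen_of_not_isPos h']
    simp only [map_sub, map_smul, LinearMap.sub_apply, LinearMap.smul_apply, smul_eq_mul,
      dualForm_stdElem, heq, hsign]
    have hne : u * w₀ ≠ x := by rintro rfl; exact h' (hpos.mpr h)
    simp only [if_neg hne]
    split_ifs <;> ring

open Classical in
lemma dualForm_ybElem (w x : P.weylGroup) : dualForm b w₀ (ybElem b w) (ybElem b x) =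
    if w * w₀ = x then (-1) ^ length b x else 0 := by
  induction w using weyl_induction b generalizing x with
  | one =>
    rw [ybElem_one, ← stdElem_one, dualForm_stdElem_left, one_mul]
    by_cases h : w₀ = x
    · subst h
      rw [stdBasis_repr_ybElem_self, if_pos rfl, mul_one]
    · rw [if_neg h]
      by_contra hne
      have hle := bruhatLE_of_stdBasis_repr_ne_zero (right_ne_zero_of_mul hne)
      -- If `h_{w₀}` occurs in `Y_x` then `w₀ ≤ x`, which forces `x = w₀`.
      exact h (BruhatLE.eq_of_length_le b hle (hw₀ x))
  | mul w i hi ih =>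
    obtain ⟨j, hij, hj⟩ := exists_opposite hw₀ i
    have hw : w * simpleRefl b i * w₀ = w * w₀ * simpleRefl b j := by
      rw [mul_assoc, ← hij, mul_assoc]
    have heq : w * simpleRefl b i * w₀ = x ↔ w * w₀ = x * simpleRefl b j := by
      rw [hw]
      constructor
      · rintro rfl; rw [mul_simpleRefl_cancel]
      · intro h; rw [h, mul_simpleRefl_cancel]
    have hpos := isPos_mul_longest_iff hw₀ hj w
    rw [ybElem_mul_simpleRefl hi, mul_add, mul_smul_comm, mul_one, map_add, map_smul,
      LinearMap.add_apply, LinearMap.smul_apply, dualForm_mul_gen hw₀ hij hj, smul_eq_mul]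
    simp only [heq]
    by_cases hwx : w * w₀ = x
    · have hne : w * w₀ ≠ x * simpleRefl b j := by
        intro h
        rw [hwx] at h
        have := isPos_mul_simpleRefl_iff b x j
        rw [← h] at this
        tauto
      obtain ⟨κ, hκ⟩ := exists_ybElem_mul_gen j x
      -- Here `x α_j = -w α_i`, so the diagonal part of `Y_x h_j` cancels exactly against `S +
      -- ybCoeff (w α_i)`.
      have hcoeff : ybCoeff (x • P.root j) = -(t₁ + t₂) - ybCoeff (w • P.root i) := by
        have hne : w • P.root i ≠ 0 := by rw [← root_smul]; exact P.ne_zero _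
        rw [← hwx, mul_smul, hj, smul_neg, ybCoeff_neg hne]
      rw [hκ, map_add, map_smul, map_smul, ih, ih, if_pos hwx, if_neg hne, hcoeff, smul_eq_mul,
        smul_zero, if_neg hne]
      ring
    · by_cases hwx' : w * w₀ = x * simpleRefl b j
      · have hx : b.IsPos (x • (j : ι)) := by
          have := isPos_mul_simpleRefl_iff b x j
          rw [← hwx', hpos] at this
          tauto
        rw [ybElem_mul_gen hx, map_sub, map_smul, ih, ih, if_neg hwx, if_pos hwx', if_pos hwx',
          length_mul_simpleRefl_of_isPos b hx, smul_zero, pow_succ]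
        ring
      · obtain ⟨κ, hκ⟩ := exists_ybElem_mul_gen j x
        rw [hκ, map_add, map_smul, map_smul, ih, ih, if_neg hwx, if_neg hwx', if_neg hwx',
          smul_zero, smul_zero]
        ring

/-- The pairing of `h_v` with `Y_{w w₀}` isolates the `Y_w`-coefficient of `h_v` when `h_v` is
expanded, and the `h_{v w₀}`-coefficient of `Y_{w w₀}` when the latter is. -/
lemma ybBasis_repr_stdElem (w v : P.weylGroup) : (ybBasis b).repr (stdElem b v) w =
    ((-1 : ℤˣ) ^ ((length b v : ℤ) - (length b w : ℤ))) •
      (stdBasis b).repr (ybElem b (w * w₀)) (v * w₀) := by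
  classical
  have := finite_weylGroup b
  have := Fintype.ofFinite P.weylGroup
  have h1 : dualForm b w₀ (stdElem b v) (ybElem b (w * w₀)) =
      (-1) ^ length b (w * w₀) * (ybBasis b).repr (stdElem b v) w := by
    conv_lhs => rw [← (ybBasis b).sum_repr (stdElem b v)]
    simp only [map_sum, map_smul, LinearMap.sum_apply, LinearMap.smul_apply, ybBasis_apply,
      dualForm_ybElem hw₀, mul_left_inj, smul_eq_mul, mul_ite, mul_zero, Finset.sum_ite_eq',
      Finset.mem_univ, if_true]
    ring
  rw [dualForm_stdElem_left] at h1
  have hv := length_mul_longest hw₀ v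
  have hw := length_mul_longest hw₀ w
  have hsign : ((-1 : ℤˣ) ^ ((length b v : ℤ) - (length b w : ℤ))) =
      (-1) ^ (length b (w * w₀)) * (-1) ^ (length b (v * w₀)) := by
    rw [← pow_add, ← zpow_natCast]
    -- From `ℓ(u w₀) = ℓ(w₀) - ℓ(u)`, the two exponents differ by an even integer.
    have : ((length b (w * w₀) + length b (v * w₀) : ℕ) : ℤ) =
        ((length b v : ℤ) - (length b w : ℤ)) + 2 * (length b (v * w₀) : ℤ) := by
      push_cast; omega
    rw [this, zpow_add, zpow_mul]
    simp
  rw [hsign, mul_smul, Units.smul_def, Units.smul_def, zsmul_eq_mul, zsmul_eq_mul]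
  push_cast
  rw [h1, neg_one_pow_mul_neg_one_pow_mul]

end Duality

end

end YangBaxter

theorem theorem1 {ι Λ Λ' : Type*} [Finite ι] [AddCommGroup Λ] [AddCommGroup Λ']
    [Module.Free ℤ Λ] [Module.Finite ℤ Λ]
    (P : RootDatum ι Λ Λ') [P.IsReduced] (b : P.Base)
    (hss : Module.finrank ℤ Λ = b.support.card) :
    ∃ (w₀ : P.weylGroup)
      (h Y : Module.Basis P.weylGroup (YangBaxter.CoeffRing Λ) (YangBaxter.GenericHecke b)),
      -- `w₀` is the longest element
      (∀ w, w ≠ w₀ → YangBaxter.length b w < YangBaxter.length b w₀) ∧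
      -- every element has a reduced expression, and `h_w`, `Y_w` are given by any of them
      (∀ w, ∃ ω, YangBaxter.IsReduced b ω ∧ YangBaxter.wordProd b ω = w) ∧
      (∀ ω, YangBaxter.IsReduced b ω →
        h (YangBaxter.wordProd b ω) = YangBaxter.stdProd b ω) ∧
      (∀ ω, YangBaxter.IsReduced b ω →
        Y (YangBaxter.wordProd b ω) = YangBaxter.ybProd b ω) ∧
      -- with `p = h.toMatrix Y` and `p̃ = Y.toMatrix h`, only `w ≤ v` occur in the expansions
      (∀ w v, h.toMatrix Y w v ≠ 0 → YangBaxter.BruhatLE b w v) ∧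
      (∀ w v, Y.toMatrix h w v ≠ 0 → YangBaxter.BruhatLE b w v) ∧
      -- the duality
      (∀ w v, Y.toMatrix h w v =
        ((-1 : ℤˣ) ^ ((YangBaxter.length b v : ℤ) - (YangBaxter.length b w : ℤ))) •
          h.toMatrix Y (v * w₀) (w * w₀)) := by
  obtain ⟨w₀, hw₀⟩ := YangBaxter.exists_longest b
  refine ⟨w₀, YangBaxter.stdBasis b, YangBaxter.ybBasis b,
    fun w hw ↦ (hw₀ w).lt_of_ne fun h ↦ hw (YangBaxter.eq_longest_of_length_eq hw₀ h),
    fun w ↦ ⟨_, YangBaxter.isReduced_reducedWord b w, YangBaxter.wordProd_reducedWord b w⟩,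
    fun ω hω ↦ ?_, fun ω hω ↦ ?_, fun w v h ↦ ?_, fun w v h ↦ ?_, fun w v ↦ ?_⟩
  · rw [YangBaxter.stdBasis_apply, YangBaxter.stdElem_wordProd hω]
  · rw [YangBaxter.ybBasis_apply, YangBaxter.ybElem_wordProd hω]
  · rw [Module.Basis.toMatrix_apply, YangBaxter.ybBasis_apply] at h
    exact YangBaxter.bruhatLE_of_stdBasis_repr_ne_zero h
  · rw [Module.Basis.toMatrix_apply, YangBaxter.stdBasis_apply] at h
    exact YangBaxter.bruhatLE_of_ybBasis_repr_ne_zero h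
  · rw [Module.Basis.toMatrix_apply, Module.Basis.toMatrix_apply, YangBaxter.ybBasis_apply,
      YangBaxter.stdBasis_apply, YangBaxter.ybBasis_repr_stdElem hw₀]
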